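/- **Definitions.** Write $e(z)=e^{2\pi i z}$. For $x\in\mathbb C$ and $q_0,\dots,q_r\in\mathbb C^*$ with $|q_j|\ne 1$, of which exactly $k$ have $|q_j|>1$, put $$(x|q_0,\dots,q_r)_\infty=\Big\{\prod_{j_0,\dots,j_r\ge 0}\Big(1-x\prod_{|q_i|>1}q_i^{-j_i-1}\prod_{|q_i|<1}q_i^{j_i}\Big)\Big\}^{(-1)^k}.$$ For $\tau,\sigma\in\mathbb C\setminus\mathbb R$ the elliptic gamma function is $$G_1(z|\tau,\sigma)=\frac{(e(\tau+\sigma-z)\,|\,e(\tau),e(\sigma))_\infty}{(e(z)\,|\,e(\tau),e(\sigma))_\infty}.$$ Let $C=\{x\in\mathbb R^2: x\cdot v_1\ge 0,\ x\cdot v_2\ge0\}$ be a good 2-dimensional cone with inward normals $v_1,v_2\in\mathbb Z^2$. That is, $C$ is strictly convex and full-dimensional, $v_1,v_2$ are primitive and neither can be omitted, and at every face of $C$ other than the apex the normals $v_{i}$ of this face are linearly independent over $\mathbb R$ and satisfy $\mathrm{Span}_{\mathbb R}\langle v_i\rangle\cap\mathbb Z^2=\mathrm{Span}_{\mathbb Z}\langle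 v_i\rangle$. Let $C^*=\{y: y\cdot u\ge 0\ \forall u\in C\}$ be the dual cone, and let $D^\circ$ denote the interior of a set $D$. For $\underline\omega\in\mathbb C^2$ with $\mathrm{Im}\,\underline\omega\in (C^*)^\circ$ put $$G_1^C(z|\underline\omega)=\frac{\prod_{n\in C^\circ\cap\mathbb Z^2}\big(1-e(-z+n\cdot\underline\omega)\big)}{\prod_{n\in C\cap\mathbb Z^2}\big(1-e(z+n\cdot\underline\omega)\big)} .$$ For a cone $D\subset\mathbb R^m$ and $\underline\eta\in\mathbb C^m$ such that $\mathrm{Re}(c\,\underline\eta)\in(D^*)^\circ$ for some $c\in\mathbb C^*$, the generalized Bernoulli polynomials $B^D_{m,k}$ are defined by $$t^m e^{zt}\sum_{n\in D^\circ\cap\mathbb Z^m}e^{-(n\cdot\underline\eta)t}=\sum_{k\ge0}B^D_{m,k}(z|\underline\eta)\frac{t^k}{k!}$$ for all sufficiently small $t\in\mathbb C$ for which the sum on the left converges absolutely. For $f=1,2$ choose any $n^f\in\mathbb Z^2$ with $\det[n^f,v_f]=\pm1$ and $n^f\cdot x>0$ for the generators $x$ of the ray $C\cap\{x\cdot v_f=0\}$.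 Let $$K_f=\begin{pmatrix}[n^f,v_f]^{-1}&0\\0&1\end{pmatrix},\qquad S=\begin{pmatrix}0&0&-1\\0&1&0\\1&0&0\end{pmatrix},$$ where $[n^f,v_f]$ is the matrix with columns $n^f,v_f$. For $g\in GL_3(\mathbb Z)$ put $$g^*G_1(z|\underline\omega)=G_1\Big(\frac{z}{w_3}\,\Big|\,\frac{w_1}{w_3},\frac{w_2}{w_3}\Big),\qquad w=g\,(\omega_1,\omega_2,1)^T.$$ **Theorem.** Let $C$ be a good 2-dimensional cone with normals $v_1,v_2$, and let $\underline\omega\in\mathbb C^2$ satisfy $\mathrm{Im}\,\underline\omega\in(C^*)^\circ$ and $\mathrm{Im}(\omega_1/\omega_2)\neq0$. Let $\tilde C\subset\mathbb R^3$ be the cone with normals $(v_1,0),(v_2,0),(0,0,1)$. Then, for every choice of $n^1,n^2$ as above: 1. the infinite products defining $G_1^C(z|\underline\omega)$ converge for every $z$; 2. the polynomials $B^{\tilde C}_{3,k}(z|\underline\omega,-1)$ are well defined; 3. $G_1^C$ and $(SK_f)^*G_1$, $f=1,2$, are meromorphic functions of $z\in\mathbb C$, and $$G_1^C(z|\underline\omega)=e^{\frac{\pi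 i}{3}B_{3,3}^{\tilde C}(z|\underline\omega,-1)}\prod_{f=1}^2 (SK_f)^*G_1(z|\underline\omega)$$ at every $z$ at which these three functions are holomorphic (hence as meromorphic functions of $z$). -/

import Mathlib

open scoped Nat Topology

noncomputable section

namespace ConeGamma

/-- The real vector with the same entries as an integer vector. -/
def toReal {m : ℕ} (w : Fin m → ℤ) : Fin m → ℝ := fun j => (w j : ℝ)

/-- The polyhedral cone `{x | x ⬝ v i ≥ 0 for all i}` with inward pointing normals `v i`. -/
def cone {m : ℕ} {ι : Type} (v : ι → Fin m → ℤ) : Set (Fin m → ℝ) :=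
  {x | ∀ i, 0 ≤ x ⬝ᵥ toReal (v i)}

/-- The dual cone `{y | y ⬝ u ≥ 0 for all u ∈ C}`. -/
def dualCone {m : ℕ} (C : Set (Fin m → ℝ)) : Set (Fin m → ℝ) :=
  {y | ∀ u ∈ C, 0 ≤ y ⬝ᵥ u}

/-- `v` is the minimal family of primitive inward normals of a good, strictly convex, rational
polyhedral cone of full dimension `m`. A nonzero point `x` of the cone lies in the relative interior
of exactly one face, and the normals of that face are the `v i` with `x ⬝ v i = 0`; so the last two
fields range over the faces of the cone other than its apex `{0}`. -/
structure IsGoodCone {m : ℕ} {ι : Type} (v : ι → Fin m → ℤ) : Prop where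
  primitive : ∀ i, Finset.univ.gcd (v i) = 1
  minimal : ∀ i, cone (fun k : {k : ι // k ≠ i} => v k) ≠ cone v
  strictlyConvex : ∀ x ∈ cone v, -x ∈ cone v → x = 0
  fullDimensional : (interior (cone v)).Nonempty
  independent : ∀ x ∈ cone v, x ≠ 0 →
    LinearIndependent ℝ (fun i : {i // x ⬝ᵥ toReal (v i) = 0} => toReal (v i))
  good : ∀ x ∈ cone v, x ≠ 0 → ∀ w : Fin m → ℤ,
    toReal w ∈ Submodule.span ℝ ((fun i => toReal (v i)) '' {i | x ⬝ᵥ toReal (v i) = 0}) ↔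
      w ∈ Submodule.span ℤ (v '' {i | x ⬝ᵥ toReal (v i) = 0})

/-- The lattice points of a set. -/
def latticePoints {m : ℕ} (C : Set (Fin m → ℝ)) : Set (Fin m → ℤ) := {n | toReal n ∈ C}

/-- `n ⬝ ω` for an integer vector `n` and a complex vector `ω`. -/
def pair {m : ℕ} (n : Fin m → ℤ) (ω : Fin m → ℂ) : ℂ := ∑ j, (n j : ℂ) * ω j

/-- `e(z) = exp (2 π i z)`. -/
def e (z : ℂ) : ℂ := Complex.exp (2 * Real.pi * Complex.I * z)

/-! ### Multiple `q`-factorials and elliptic gamma functions -/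

open Classical in
/-- The `q`-shifted factorial `(x | q)_∞` for parameters with `‖q i‖ ≠ 1`. If `k` of the parameters
lie outside the unit disc, it is the `(-1) ^ k`-th power of
`∏_j (1 - x ∏_{‖q i‖ > 1} (q i) ^ (-j i - 1) ∏_{‖q i‖ < 1} (q i) ^ (j i))`. -/
def qFactorial {m : ℕ} (x : ℂ) (q : Fin m → ℂ) : ℂ :=
  (∏' j : Fin m → ℕ,
      (1 - x * ∏ i, if 1 < ‖q i‖ then (q i)⁻¹ ^ (j i + 1) else q i ^ j i)) ^
    ((-1 : ℤ) ^ (Finset.univ.filter fun i => 1 < ‖q i‖).card)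

/-- The multiple elliptic gamma function
`G_r(z | ω) = (x⁻¹ q_0 ⋯ q_r | q)_∞ (x | q)_∞ ^ ((-1) ^ r)`, where `x = e(z)`, `q_j = e(ω_j)`. -/
def G (r : ℕ) (z : ℂ) (ω : Fin (r + 1) → ℂ) : ℂ :=
  qFactorial ((e z)⁻¹ * ∏ j, e (ω j)) (fun j => e (ω j)) *
    qFactorial (e z) (fun j => e (ω j)) ^ ((-1 : ℤ) ^ r)

/-- The generalized multiple elliptic gamma function `G_r^C(z | ω)` of the cone `C` with
normals `v`. -/
def coneG (r : ℕ) {ι : Type} (v : ι → Fin (r + 1) → ℤ) (z : ℂ) (ω : Fin (r + 1) → ℂ) : ℂ :=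
  (∏' n : latticePoints (cone v), (1 - e (z + pair n ω))) ^ ((-1 : ℤ) ^ r) *
    ∏' n : latticePoints (interior (cone v)), (1 - e (-z + pair n ω))

/-! ### Generalized Bernoulli polynomials -/

/-- `b k = B_{m,k}^C(z | ω)` for all `k`, where `C` is the cone with normals `v`: some `c ≠ 0` has
`Re (c ω)` in the interior of the dual cone, and
`t ^ m exp(z t) ∑_{n ∈ C° ∩ ℤ^m} exp(-(n ⬝ ω) t) = ∑_k b k t ^ k / k!`
for all small `t` for which the sum on the left converges absolutely. -/
def IsBernoulli {m : ℕ} {ι : Type} (v : ι → Fin m → ℤ) (ω : Fin m → ℂ) (z : ℂ) (b : ℕ → ℂ) :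
    Prop :=
  (∃ c : ℂ, c ≠ 0 ∧ (fun j => (c * ω j).re) ∈ interior (dualCone (cone v))) ∧
  ∀ᶠ t in 𝓝 (0 : ℂ),
    Summable (fun n : latticePoints (interior (cone v)) => Complex.exp (-(pair n ω) * t)) →
    HasSum (fun k : ℕ => b k * t ^ k / (k ! : ℂ))
      (t ^ m * Complex.exp (z * t) *
        ∑' n : latticePoints (interior (cone v)), Complex.exp (-(pair n ω) * t))

open Classical in
/-- The generalized Bernoulli polynomial `B_{m,k}^C(z | ω)`. -/
def bernoulli {m : ℕ} {ι : Type} (v : ι → Fin m → ℤ) (k : ℕ) (z : ℂ) (ω : Fin m → ℂ) : ℂ :=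
  if h : ∃ b, IsBernoulli v ω z b then h.choose k else 0

/-! ### The matrices attached to the faces of a two-dimensional cone -/

/-- The matrix `[n, v]` with columns `n` and `v`. -/
def columns (n v : Fin 2 → ℤ) : Matrix (Fin 2) (Fin 2) ℤ := !![n 0, v 0; n 1, v 1]

/-- `n` is an admissible choice of the vector `n^f` at the ray `f` of the cone on which
`x ⬝ v f = 0`: `det [n, v f] = ±1`, and `n ⬝ x > 0` for the generators `x` of this ray. -/
def IsFaceVector (v : Fin 2 → Fin 2 → ℤ) (f : Fin 2) (n : Fin 2 → ℤ) : Prop :=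
  ((columns n (v f)).det = 1 ∨ (columns n (v f)).det = -1) ∧
    ∀ x ∈ cone v, x ⬝ᵥ toReal (v f) = 0 → x ≠ 0 → 0 < toReal n ⬝ᵥ x

/-- The matrix `K`, which is `[n, v]⁻¹` bordered by a `1` in the lower right corner. -/
def K (n v : Fin 2 → ℤ) : Matrix (Fin 3) (Fin 3) ℤ :=
  !![(columns n v)⁻¹ 0 0, (columns n v)⁻¹ 0 1, 0;
     (columns n v)⁻¹ 1 0, (columns n v)⁻¹ 1 1, 0;
     0, 0, 1]

/-- The `S`-duality matrix. -/
def S : Matrix (Fin 3) (Fin 3) ℤ :=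
  !![0, 0, -1;
     0, 1, 0;
     1, 0, 0]

/-- `g ⬝ (ω, 1)`. -/
def homogeneous (g : Matrix (Fin 3) (Fin 3) ℤ) (ω : Fin 2 → ℂ) : Fin 3 → ℂ :=
  (g.map (fun a : ℤ => (a : ℂ))).mulVec ![ω 0, ω 1, 1]

/-- `(g^* G_1)(z | ω) = G_1(z / w_3 | w_1 / w_3, w_2 / w_3)`, where `w = g ⬝ (ω, 1)`: the pull-back
of `G_1` under the action of `g` by linear fractional transformations. -/
def pullbackG (g : Matrix (Fin 3) (Fin 3) ℤ) (z : ℂ) (ω : Fin 2 → ℂ) : ℂ :=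
  G 1 (z / homogeneous g ω 2)
    ![homogeneous g ω 0 / homogeneous g ω 2, homogeneous g ω 1 / homogeneous g ω 2]

/-- The normals `(v_1, 0)`, `(v_2, 0)`, `(0, 0, 1)` of the three-dimensional cone `C × ℝ_{≥ 0}`. -/
def tildeNormals (v : Fin 2 → Fin 2 → ℤ) : Fin 3 → Fin 3 → ℤ :=
  ![![v 0 0, v 0 1, 0], ![v 1 0, v 1 1, 0], ![0, 0, 1]]

end ConeGamma

end

/-! Let `a`, `c` be the pairings of `ω` with the primitive generators of the two rays of `C`, and
let `N` be the index of the sublattice that these generators span. The parallelogram on them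
contains `N` lattice points `P` (half-open, `fundPoint`). The lattice points of `C` are the `P` plus
natural combinations of the generators, and the interior ones are the reflected points (sum of the
generators minus `P`) plus such combinations. Hence, on logarithms, `coneG 1` is the product of
`G_1(z + P | a, c)` over all `P` (`coneG_one_eq_exp`).

In its fundamental strip, `log G_1(z | τ, σ)` is the bilateral series with terms `e(kz) / (k (e(kτ)
- 1)(e(kσ) - 1))`, `k ≠ 0` (`G_one_eq_exp`). Such terms are `2πi` times residues of `exp(wt) / (t
(exp(at) - 1)(exp(ct) - 1)(exp(-t) - 1))`. Its three families of nonzero poles produce the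
logarithms of `G_1(w/a | -1/a, c/a)`, `G_1(w/c | -1/c, a/c)` and, with a minus sign, `G_1(w | a,
c)`; the pole at `0` produces the cubic Bernoulli term. If `w = s₀ a + s₁ c - s₂` with all `sᵢ` in
`(0, 1)`, the integrand decays exponentially on suitable large circles, so the residues add up to
zero (`tripleResidue_sum_eq_zero`, `gammaTerm_modular`).

Now take `w = z + P` and sum over `P`. The Bernoulli terms add up to that of `C × ℝ_{≥ 0}`
(`generating_eq_sum_tripleGenerating`). At the face `f` the numbers `P ⬝ v_f` run once through the
residues mod `N`, and a finite geometric sum collapses the `N` factors to the single function `(S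
K_f)^* G_1` (`sum_gammaTerm_fundPoint`). This settles a segment of values of `z` on which every
series converges; the identity theorem for meromorphic functions does the rest. -/

section EllipticGammaModularity

open Filter Topology Metric

/-! ### Residues on a disc and simple poles -/

/-- The residue theorem on a disc, in terms of explicit principal parts `π i` at finitely many
points `p i`. -/
theorem circleIntegral_eq_sum_of_principalParts {ι : Type*} [DecidableEq ι] (s : Finset ι)
    (p : ι → ℂ) (hp : Set.InjOn p s) (π : ι → ℂ → ℂ) (ρ : ι → ℂ) {R : ℝ} (hR : 0 < R)
    (F : ℂ → ℂ) (hball : ∀ i ∈ s, ‖p i‖ < R)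
    (hF : ∀ t ∈ closedBall (0 : ℂ) R, (∀ i ∈ s, t ≠ p i) → AnalyticAt ℂ F t)
    (hπ : ∀ i ∈ s, ∀ t, t ≠ p i → AnalyticAt ℂ (π i) t)
    (hint : ∀ i ∈ s, (∮ t in C(0, R), π i t) = ρ i)
    (hsub : ∀ i ∈ s, ∃ g, AnalyticAt ℂ g (p i) ∧ ∀ᶠ t in 𝓝[≠] (p i), F t = π i t + g t) :
    (∮ t in C(0, R), F t) = ∑ i ∈ s, ρ i := by
  set D : ℂ → ℂ := fun t => F t - ∑ i ∈ s, π i t with hD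
  have hsphere : ∀ t ∈ sphere (0 : ℂ) R, ∀ i ∈ s, t ≠ p i := by
    rintro t ht i hi rfl
    have := hball i hi
    simp at ht
    linarith
  have hreg : ∀ t ∈ closedBall (0 : ℂ) R, ∃ g, AnalyticAt ℂ g t ∧ D =ᶠ[𝓝[≠] t] g := by
    intro t ht
    by_cases h : ∃ i ∈ s, t = p i
    · obtain ⟨i, hi, rfl⟩ := h
      obtain ⟨g, hg, hFg⟩ := hsub i hi
      refine ⟨fun t => g t - ∑ j ∈ s.erase i, π j t, hg.sub ?_, ?_⟩
      · refine Finset.analyticAt_fun_sum _ fun j hj => hπ j (Finset.mem_of_mem_erase hj) _ ?_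
        exact fun h => Finset.ne_of_mem_erase hj (hp (Finset.mem_of_mem_erase hj) hi h.symm)
      · filter_upwards [hFg] with t ht
        simp only [hD, ht, ← Finset.add_sum_erase s (fun j => π j t) hi]
        ring
    · push Not at h
      exact ⟨D, (hF t ht h).sub (Finset.analyticAt_fun_sum _ fun j hj => hπ j hj _ (h j hj)),
        EventuallyEq.rfl⟩
  have hmer : MeromorphicOn D (closedBall 0 R) := by
    intro t ht
    obtain ⟨g, hg, hDg⟩ := hreg t ht
    exact hg.meromorphicAt.congr hDg.symm
  -- All singularities of `D` in the disc are removable. Passing to the meromorphic normal form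
  -- fills them in without changing `D` on the circle, so Cauchy's theorem applies to the normal
  -- form.
  have hNF : ∀ t ∈ closedBall (0 : ℂ) R,
      AnalyticAt ℂ (toMeromorphicNFOn D (closedBall 0 R)) t := by
    intro t ht
    rw [← ((meromorphicNFOn_toMeromorphicNFOn D (closedBall 0 R)) ht
      ).meromorphicOrderAt_nonneg_iff_analyticAt]
    obtain ⟨g, hg, hDg⟩ := hreg t ht
    rw [meromorphicOrderAt_congr ((hmer.toMeromorphicNFOn_eq_self_on_nhdsNE ht).trans hDg)]
    exact hg.meromorphicOrderAt_nonneg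
  have hDan : ∀ t ∈ sphere (0 : ℂ) R, AnalyticAt ℂ D t := fun t ht =>
    (hF t (sphere_subset_closedBall ht) (hsphere t ht)).sub
      (Finset.analyticAt_fun_sum _ fun j hj => hπ j hj _ (hsphere t ht j hj))
  have hDint : (∮ t in C(0, R), D t) = 0 := by
    rw [circleIntegral.integral_congr hR.le
      (g := toMeromorphicNFOn D (closedBall 0 R))]
    · refine Complex.circleIntegral_eq_zero_of_differentiable_on_off_countable hR.le
        Set.countable_empty (fun t ht => (hNF t ht).continuousAt.continuousWithinAt)
        fun t ht => (hNF t (ball_subset_closedBall ht.1)).differentiableAt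
    · intro t ht
      have h := hmer.toMeromorphicNFOn_eq_self_on_nhdsNE (sphere_subset_closedBall ht)
      have := eventuallyEq_nhds_of_eventuallyEq_nhdsNE h ?_
      · exact this.eq_of_nhds.symm
      · exact tendsto_nhds_unique (((hNF t (sphere_subset_closedBall ht)).continuousAt.tendsto.mono_left
          nhdsWithin_le_nhds).congr' h) ((hDan t ht).continuousAt.tendsto.mono_left
          nhdsWithin_le_nhds)
  have hπi : ∀ i ∈ s, CircleIntegrable (π i) 0 R := fun i hi =>
    ContinuousOn.circleIntegrable hR.le fun t ht =>
      (hπ i hi t (hsphere t ht i hi)).continuousAt.continuousWithinAt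
  have hFi : CircleIntegrable F 0 R := ContinuousOn.circleIntegrable hR.le fun t ht =>
      (hF t (sphere_subset_closedBall ht) (hsphere t ht)).continuousAt.continuousWithinAt
  rw [circleIntegral.integral_sub hFi, circleIntegral.integral_fun_sum hπi,
    sub_eq_zero, Finset.sum_congr rfl hint] at hDint
  · exact hDint
  · exact CircleIntegrable.fun_sum _ hπi

/-- A quotient of analytic functions at a simple zero of the denominator. -/
theorem exists_analyticAt_simplePole {f h : ℂ → ℂ} {p h' : ℂ} (hf : AnalyticAt ℂ f p)
    (hh : AnalyticAt ℂ h p) (h0 : h p = 0) (hd : HasDerivAt h h' p) (h1 : h' ≠ 0) :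
    ∃ g, AnalyticAt ℂ g p ∧ ∀ᶠ t in 𝓝[≠] p, f t / h t = f p / h' * (t - p)⁻¹ + g t := by
  have hds : ∀ {k : ℂ → ℂ}, AnalyticAt ℂ k p → AnalyticAt ℂ (dslope k p) p := by
    rintro k ⟨q, hq⟩
    exact ⟨_, hq.has_fpower_series_dslope_fslope⟩
  have hdp : dslope h p p = h' := by rw [dslope_same, hd.deriv]
  have hA : AnalyticAt ℂ (fun t => f t / dslope h p t) p := hf.div (hds hh) (by rwa [hdp])
  refine ⟨_, hds hA, ?_⟩
  filter_upwards [self_mem_nhdsWithin] with t ht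
  have ht : t - p ≠ 0 := sub_ne_zero.mpr ht
  rw [dslope_of_ne _ (sub_ne_zero.mp ht), slope_def_field, dslope_of_ne _ (sub_ne_zero.mp ht),
    slope_def_field, hdp, h0, sub_zero]
  field_simp
  ring

/-! ### Estimates for exponentials, and radii that avoid the poles -/

/-- `exp w - 1` is bounded below away from the period lattice of `exp`. -/
theorem Complex.exists_le_norm_exp_sub_one {η : ℝ} (hη : 0 < η) :
    ∃ c > 0, ∀ w : ℂ, (∀ k : ℤ, η ≤ ‖w - k * (2 * Real.pi * Complex.I)‖) →
      c ≤ ‖Complex.exp w - 1‖ := by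
  refine ⟨min (1 / 2) (η / 2), by positivity, fun w hw => ?_⟩
  by_contra! h
  obtain ⟨h1, h2⟩ := lt_min_iff.mp h
  -- If `exp w` is within `min (1 / 2) (η / 2)` of `1`, its principal logarithm has norm at most `3
  -- / 2 * (η / 2) < η`, and it differs from `w` by a period.
  have hlog := Complex.norm_log_one_add_half_le_self h1.le
  have hne : (1 : ℂ) + (Complex.exp w - 1) ≠ 0 := by simp
  have := Complex.exp_log hne
  rw [add_sub_cancel] at this hlog
  obtain ⟨k, hk⟩ := Complex.exp_eq_exp_iff_exists_int.mp this.symm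
  have h3 := hw k
  rw [show w - k * (2 * Real.pi * Complex.I) = Complex.log (Complex.exp w) from
    sub_eq_iff_eq_add.mpr hk] at h3
  linarith

/-- For `w.re ≥ 0` the denominator is comparable to `exp w`, leaving decay at rate `1 - s`; for
`w.re ≤ 0` it is bounded below, and the numerator decays at rate `s`. With `s` in `(0, 1)` there is
decay in both directions. -/
theorem Complex.norm_exp_div_exp_sub_one_le {c s : ℝ} (hc : 0 < c) {w : ℂ}
    (h1 : c ≤ ‖Complex.exp w - 1‖) (h2 : c ≤ ‖Complex.exp (-w) - 1‖) :
    ‖Complex.exp (s * w) / (Complex.exp w - 1)‖ ≤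
      c⁻¹ * Real.exp (-(min s (1 - s) * |w.re|)) := by
  have h3 : c * Real.exp w.re ≤ ‖Complex.exp w - 1‖ := by
    calc c * Real.exp w.re ≤ ‖Complex.exp (-w) - 1‖ * ‖Complex.exp w‖ := by
          rw [Complex.norm_exp]; gcongr
      _ = ‖Complex.exp w - 1‖ := by
          rw [← norm_mul, sub_mul, ← Complex.exp_add, neg_add_cancel, Complex.exp_zero, one_mul,
            norm_sub_rev]
  rw [norm_div, Complex.norm_exp, div_le_iff₀ (by linarith)]
  have hre : ((s : ℂ) * w).re = s * w.re := by simp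
  rw [hre]
  rcases le_total 0 w.re with h | h
  · calc Real.exp (s * w.re) = c⁻¹ * Real.exp (-((1 - s) * w.re)) * (c * Real.exp w.re) := by
          rw [mul_mul_mul_comm, inv_mul_cancel₀ hc.ne', one_mul, ← Real.exp_add]; ring_nf
      _ ≤ _ := by
          rw [abs_of_nonneg h]
          gcongr
          exact min_le_right _ _
  · calc Real.exp (s * w.re) = c⁻¹ * Real.exp (-(s * -w.re)) * c := by
          rw [mul_right_comm, inv_mul_cancel₀ hc.ne', one_mul]; ring_nf
      _ ≤ _ := by
          rw [abs_of_nonpos h]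
          gcongr
          · linarith
          · exact min_le_left _ _

/-- If two complex numbers have non-real ratio, then their products with `t` cannot both have
small real part. -/
theorem Complex.exists_le_abs_re_add_abs_re {α β : ℂ} (h : (α / β).im ≠ 0) :
    ∃ κ > 0, ∀ t : ℂ, κ * ‖t‖ ≤ |(α * t).re| + |(β * t).re| := by
  have hβ : β ≠ 0 := by rintro rfl; simp at h
  have hα : α ≠ 0 := by rintro rfl; simp at h
  set J : ℝ := (α * starRingEnd ℂ β).im with hJ
  have hJ0 : J ≠ 0 := by
    rw [div_eq_mul_inv, Complex.inv_def, ← mul_assoc, Complex.im_mul_ofReal] at h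
    exact left_ne_zero_of_mul h
  refine ⟨|J| / (‖α‖ + ‖β‖), by positivity, fun t => ?_⟩
  -- This combination of the two real parts eliminates the conjugate of `t`.
  have key : (((α * t).re : ℝ) : ℂ) * starRingEnd ℂ β - ((β * t).re : ℝ) * starRingEnd ℂ α =
      t * (J * Complex.I) := by
    apply Complex.ext <;> simp [hJ] <;> ring
  have hn := congrArg norm key
  simp only [norm_mul, Complex.norm_real, Complex.norm_I, mul_one, Real.norm_eq_abs] at hn
  have h1 := norm_sub_le ((((α * t).re : ℝ) : ℂ) * starRingEnd ℂ β)
    (((β * t).re : ℝ) * starRingEnd ℂ α)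
  simp only [norm_mul, Complex.norm_real, Real.norm_eq_abs, RCLike.norm_conj] at h1
  rw [hn] at h1
  rw [div_mul_eq_mul_div, div_le_iff₀ (by positivity)]
  nlinarith [mul_nonneg (abs_nonneg (α * t).re) (norm_nonneg α),
    mul_nonneg (abs_nonneg (β * t).re) (norm_nonneg β)]

/-- A short interval contains a third of itself on which `β R` stays away from the integers. -/
theorem exists_third_away_from_int {β ℓ : ℝ} (hβ : 0 < β) (hℓ : 0 < ℓ) (h : ℓ * β ≤ 1 / 2) (A : ℝ) :
    ∃ A', A ≤ A' ∧ A' + ℓ / 3 ≤ A + ℓ ∧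
      ∀ R, A' ≤ R → R ≤ A' + ℓ / 3 → ∀ k : ℤ, β * ℓ / 6 ≤ |R * β - k| := by
  by_contra! hcon
  -- If both outer thirds contain a bad point, the two nearby integers coincide because `ℓ * β ≤ 1 /
  -- 2`. Then the values `R * β` differ by less than `2 * (β * ℓ / 6)`, whereas the points are at
  -- least `ℓ / 3` apart.
  obtain ⟨R₁, h1, h1', k₁, hk₁⟩ := hcon A le_rfl (by linarith)
  obtain ⟨R₂, h2, h2', k₂, hk₂⟩ := hcon (A + 2 * ℓ / 3) (by linarith) (by linarith)
  rw [abs_lt] at hk₁ hk₂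
  have e1 : (R₂ - R₁) * β ≤ ℓ * β := by gcongr; linarith
  have e2 : ℓ / 3 * β ≤ (R₂ - R₁) * β := by gcongr; linarith
  have hk : k₁ = k₂ := by
    have a1 : ((k₂ - k₁ : ℤ) : ℝ) < 1 := by push_cast; nlinarith
    have a2 : (-1 : ℝ) < ((k₂ - k₁ : ℤ) : ℝ) := by push_cast; nlinarith
    have b1 : k₂ - k₁ < 1 := by exact_mod_cast a1
    have b2 : -1 < k₂ - k₁ := by exact_mod_cast a2
    omega
  subst hk
  nlinarith

/-- Supplies circles of arbitrarily large radius that keep a uniform distance from all three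
families of poles. Three nested applications of the previous lemma treat the three frequencies in
turn. -/
theorem exists_ge_away_from_int (β : Fin 3 → ℝ) (hβ : ∀ i, 0 < β i) :
    ∃ ε > 0, ∀ A : ℝ, ∃ R ≥ A, ∀ i, ∀ k : ℤ, ε ≤ |R * β i - k| := by
  set B := β 0 + β 1 + β 2 with hB
  have h0 := hβ 0
  have h1 := hβ 1
  have h2 := hβ 2
  have hBp : 0 < B := by positivity
  set ℓ := 1 / (2 * B) with hℓ
  have hℓp : 0 < ℓ := by positivity
  have hle : ∀ i, β i ≤ B := fun i => by fin_cases i <;> simp [hB] <;> linarith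
  have hs : ∀ i, ℓ * β i ≤ 1 / 2 := fun i => by
    rw [hℓ, div_mul_eq_mul_div, div_le_div_iff₀ (by positivity) (by norm_num)]
    linarith [hle i]
  -- The last of the three applications starts from an interval of length `ℓ / 9`, and `9 * 6 = 54`.
  obtain ⟨ε, hε, hεi⟩ : ∃ ε > 0, ∀ i, ε ≤ β i * ℓ / 54 := by
    refine ⟨min (β 0) (min (β 1) (β 2)) * ℓ / 54, by positivity, fun i => ?_⟩
    gcongr
    fin_cases i <;> simp
  refine ⟨ε, hε, fun A => ?_⟩
  obtain ⟨A₀, ha0, hb0, hc0⟩ := exists_third_away_from_int h0 hℓp (hs 0) A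
  obtain ⟨A₁, ha1, hb1, hc1⟩ := exists_third_away_from_int h1 (ℓ := ℓ / 3) (by positivity)
    (by nlinarith [hs 1]) A₀
  obtain ⟨A₂, ha2, hb2, hc2⟩ := exists_third_away_from_int h2 (ℓ := ℓ / 3 / 3) (by positivity)
    (by nlinarith [hs 2]) A₁
  refine ⟨A₂, by linarith, fun i k => (hεi i).trans ?_⟩
  have p0 := mul_pos h0 hℓp
  have p1 := mul_pos h1 hℓp
  have p2 := mul_pos h2 hℓp
  fin_cases i
  · exact le_trans (by simp only [Fin.zero_eta]; linarith) (hc0 A₂ (by linarith) (by linarith) k)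
  · exact le_trans (by simp only [Fin.mk_one]; linarith) (hc1 A₂ (by linarith) (by linarith) k)
  · exact le_trans (by simp only [Fin.reduceFinMk]; linarith)
      (hc2 A₂ (by linarith) (by linarith) k)

/-! ### The integrand, its poles and its principal parts -/

/-- The function `t ^ 3 * exp (z * t) / ∏ i, (exp (α i * t) - 1)`, extended over `t = 0`. -/
noncomputable def tripleGenerating (α : Fin 3 → ℂ) (z t : ℂ) : ℂ :=
  Complex.exp (z * t) * ∏ i, (α i * dslope Complex.exp 0 (α i * t))⁻¹

theorem Complex.analyticAt_dslope_exp (w : ℂ) : AnalyticAt ℂ (dslope Complex.exp 0) w := by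
  have h : Differentiable ℂ (dslope Complex.exp 0) := by
    rw [← differentiableOn_univ, Complex.differentiableOn_dslope univ_mem, differentiableOn_univ]
    exact Complex.differentiable_exp
  exact h.analyticAt w

theorem analyticAt_tripleGenerating {α : Fin 3 → ℂ} (hα : ∀ i, α i ≠ 0) (z : ℂ) :
    AnalyticAt ℂ (tripleGenerating α z) 0 := by
  refine AnalyticAt.mul (by fun_prop) (Finset.analyticAt_fun_prod _ fun i _ => AnalyticAt.inv ?_ ?_)
  · exact analyticAt_const.mul ((Complex.analyticAt_dslope_exp _).comp (by fun_prop))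
  · simp [hα i]

theorem tripleGenerating_eq {α : Fin 3 → ℂ} (hα : ∀ i, α i ≠ 0) (z : ℂ) {t : ℂ} (ht : t ≠ 0) :
    tripleGenerating α z t =
      t ^ 3 * Complex.exp (z * t) * ∏ i, (Complex.exp (α i * t) - 1)⁻¹ := by
  have h : ∀ i, (α i * dslope Complex.exp 0 (α i * t))⁻¹ = t * (Complex.exp (α i * t) - 1)⁻¹ := by
    intro i
    have : α i * t ≠ 0 := mul_ne_zero (hα i) ht
    have hi := hα i
    rw [dslope_of_ne _ this, slope_def_field, sub_zero, Complex.exp_zero,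
      show α i * ((Complex.exp (α i * t) - 1) / (α i * t)) = (Complex.exp (α i * t) - 1) / t by
        field_simp, inv_div, div_eq_mul_inv]
  simp only [tripleGenerating, h, Finset.prod_mul_distrib, Finset.prod_const, Finset.card_univ,
    Fintype.card_fin]
  ring

section Residues

variable {α : Fin 3 → ℂ} {z : ℂ}

/-- The integrand `exp (z * t) / (t * ∏ i, (exp (α i * t) - 1))`. -/
noncomputable def tripleIntegrand (α : Fin 3 → ℂ) (z t : ℂ) : ℂ :=
  Complex.exp (z * t) / (t * ∏ i, (Complex.exp (α i * t) - 1))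

/-- The poles of `tripleIntegrand`. -/
noncomputable def triplePole (α : Fin 3 → ℂ) : Option (Σ _ : Fin 3, ℤ) → ℂ
  | none => 0
  | some x => x.2 * (2 * Real.pi * Complex.I) / α x.1

/-- The residue of `tripleIntegrand` at a nonzero pole, times `2 * π * I`. -/
noncomputable def tripleResidue (α : Fin 3 → ℂ) (z : ℂ) (i : Fin 3) (k : ℤ) : ℂ :=
  (k : ℂ)⁻¹ * Complex.exp (2 * Real.pi * Complex.I * (k * (z / α i))) *
    ∏ j ∈ Finset.univ.erase i, (Complex.exp (2 * Real.pi * Complex.I * (k * (α j / α i))) - 1)⁻¹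

theorem ne_zero_of_im_div_ne_zero (hα : ∀ i j, i ≠ j → (α i / α j).im ≠ 0) (i : Fin 3) :
    α i ≠ 0 := by
  intro h
  have := hα i (i + 1) (by fin_cases i <;> simp)
  simp [h] at this

theorem exp_two_pi_mul_ne_one {x : ℂ} (hx : x.im ≠ 0) {k : ℤ} (hk : k ≠ 0) :
    Complex.exp (2 * Real.pi * Complex.I * (k * x)) ≠ 1 := by
  intro h
  obtain ⟨n, hn⟩ := Complex.exp_eq_one_iff.mp h
  have h2 : (k : ℂ) * x = n := by
    have := Complex.two_pi_I_ne_zero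
    apply mul_left_cancel₀ this
    rw [hn]; ring
  have := congrArg Complex.im h2
  rw [← Complex.ofReal_intCast, Complex.im_ofReal_mul] at this
  simp [hk, hx] at this

theorem triplePole_mul (i j : Fin 3) (k : ℤ) :
    α j * triplePole α (some ⟨i, k⟩) = 2 * Real.pi * Complex.I * (k * (α j / α i)) := by
  simp only [triplePole]
  ring

theorem tripleIntegrand_analyticAt {t : ℂ} (ht : t ≠ 0) (h : ∀ i, Complex.exp (α i * t) ≠ 1) :
    AnalyticAt ℂ (tripleIntegrand α z) t := by
  refine AnalyticAt.div (by fun_prop) (by fun_prop) (mul_ne_zero ht ?_)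
  exact Finset.prod_ne_zero_iff.mpr fun i _ => sub_ne_zero.mpr (h i)

/-- The integrand is `tripleGenerating` divided by `t ^ 4`, so the Taylor terms of degree below `4`
form the polar part. -/
theorem tripleIntegrand_principalPart_zero (hα : ∀ i, α i ≠ 0) :
    ∃ g, AnalyticAt ℂ g 0 ∧ ∀ᶠ t in 𝓝[≠] (0 : ℂ), tripleIntegrand α z t =
      ∑ m ∈ Finset.range 4, iteratedDeriv m (tripleGenerating α z) 0 / m.factorial *
        t ^ ((m : ℤ) - 4) + g t := by
  obtain ⟨g, hg, h⟩ := (analyticAt_tripleGenerating hα z).exists_eq_sum_add_pow_mul 4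
  refine ⟨g, hg, ?_⟩
  filter_upwards [self_mem_nhdsWithin] with t ht
  have ht : t ≠ 0 := ht
  have h1 : tripleIntegrand α z t = tripleGenerating α z t * t ^ (-4 : ℤ) := by
    rw [tripleGenerating_eq hα z ht, tripleIntegrand, zpow_neg, Finset.prod_inv_distrib]
    field_simp
  have h4 : t ^ (4 : ℕ) * t ^ (-4 : ℤ) = 1 := by
    rw [zpow_neg]; norm_cast; exact mul_inv_cancel₀ (pow_ne_zero _ ht)
  rw [h1, h t, add_mul, Finset.sum_mul, smul_eq_mul, mul_right_comm, h4, one_mul]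
  congr 1
  refine Finset.sum_congr rfl fun m _ => ?_
  rw [sub_eq_add_neg, zpow_add₀ ht, zpow_natCast, smul_eq_mul]
  ring

/-- Only the `i`-th factor vanishes at this pole: for `j ≠ i` the number `k * (α j / α i)` is not
real. The zero is simple, with derivative `α i`. -/
theorem tripleIntegrand_principalPart (hα : ∀ i j, i ≠ j → (α i / α j).im ≠ 0) (i : Fin 3)
    {k : ℤ} (hk : k ≠ 0) :
    ∃ g, AnalyticAt ℂ g (triplePole α (some ⟨i, k⟩)) ∧
      ∀ᶠ t in 𝓝[≠] (triplePole α (some ⟨i, k⟩)), tripleIntegrand α z t =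
        tripleResidue α z i k / (2 * Real.pi * Complex.I) *
          (t - triplePole α (some ⟨i, k⟩))⁻¹ + g t := by
  have hα0 := ne_zero_of_im_div_ne_zero hα
  set p := triplePole α (some ⟨i, k⟩) with hp
  have hpi : ∀ j, α j * p = 2 * Real.pi * Complex.I * (k * (α j / α i)) :=
    fun j => triplePole_mul i j k
  have hk' : (k : ℂ) ≠ 0 := by exact_mod_cast hk
  have hp0 : p ≠ 0 := by
    have := Complex.two_pi_I_ne_zero
    simp only [hp, triplePole]
    exact div_ne_zero (mul_ne_zero hk' this) (hα0 i)
  have hexp : Complex.exp (α i * p) = 1 := by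
    rw [hpi, div_self (hα0 i), mul_one, mul_comm, Complex.exp_int_mul_two_pi_mul_I]
  have hne : ∀ j ∈ Finset.univ.erase i, Complex.exp (α j * p) - 1 ≠ 0 := by
    intro j hj
    rw [hpi, sub_ne_zero]
    exact exp_two_pi_mul_ne_one (hα j i (Finset.ne_of_mem_erase hj)) hk
  obtain ⟨g, hg, h⟩ := exists_analyticAt_simplePole (p := p) (h' := α i)
    (f := fun t => Complex.exp (z * t) /
      (t * ∏ j ∈ Finset.univ.erase i, (Complex.exp (α j * t) - 1)))
    (h := fun t => Complex.exp (α i * t) - 1)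
    (AnalyticAt.div (by fun_prop) (by fun_prop)
      (mul_ne_zero hp0 (Finset.prod_ne_zero_iff.mpr hne))) (by fun_prop)
    (by simp [hexp]) (by
      have := (((hasDerivAt_id p).const_mul (α i)).cexp).sub_const 1
      simpa [hexp] using this) (hα0 i)
  refine ⟨g, hg, ?_⟩
  filter_upwards [h] with t ht
  rw [tripleIntegrand, ← Finset.mul_prod_erase Finset.univ _ (Finset.mem_univ i),
    ← mul_assoc, mul_right_comm, ← div_div, ht]
  congr 2
  rw [tripleResidue, Finset.prod_inv_distrib]
  simp only [hpi]
  have hz : z * p = 2 * Real.pi * Complex.I * (k * (z / α i)) := by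
    simp only [hp, triplePole]; ring
  have hpp : p = (2 * Real.pi * Complex.I) * k / α i := by
    simp only [hp, triplePole]; ring
  rw [hz, hpp]
  have := Complex.two_pi_I_ne_zero
  have := hα0 i
  generalize (2 * (Real.pi : ℂ) * Complex.I) = c at *
  field_simp

end Residues

/-! ### Contour integration over growing circles -/

section ContourIntegral

variable {α : Fin 3 → ℂ} {z : ℂ}

/-- The indices of the poles of `tripleIntegrand` in the disc of radius `R` about `0`. -/
noncomputable def triplePoleIndices (α : Fin 3 → ℂ) (R : ℝ) : Finset (Option (Σ _ : Fin 3, ℤ)) :=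
  Finset.insertNone (Finset.univ.sigma fun i =>
    (Finset.Icc (-⌊R * (‖α i‖ / (2 * Real.pi))⌋) ⌊R * (‖α i‖ / (2 * Real.pi))⌋).erase 0)

theorem some_mem_triplePoleIndices {R : ℝ} {i : Fin 3} {k : ℤ} :
    some ⟨i, k⟩ ∈ triplePoleIndices α R ↔
      k ≠ 0 ∧ (|k| : ℝ) ≤ R * (‖α i‖ / (2 * Real.pi)) := by
  simp only [triplePoleIndices, Finset.mem_insertNone, Option.mem_some_iff, forall_eq',
    Finset.mem_sigma, Finset.mem_univ, Finset.mem_erase, Finset.mem_Icc, true_and]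
  rw [← abs_le, Int.le_floor, Int.cast_abs]

/-- Two coinciding nonzero poles of different families would make `α i / α j` rational. -/
theorem triplePole_injOn (hα : ∀ i j, i ≠ j → (α i / α j).im ≠ 0) (R : ℝ) :
    Set.InjOn (triplePole α) (triplePoleIndices α R) := by
  have hα0 := ne_zero_of_im_div_ne_zero hα
  have h2 := Complex.two_pi_I_ne_zero
  have key : ∀ i (k : ℤ), some ⟨i, k⟩ ∈ triplePoleIndices α R → triplePole α (some ⟨i, k⟩) ≠ 0 := by
    intro i k h
    have hk : (k : ℂ) ≠ 0 := by exact_mod_cast (some_mem_triplePoleIndices.mp h).1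
    exact div_ne_zero (mul_ne_zero hk h2) (hα0 i)
  rintro (_ | ⟨i, k⟩) hx (_ | ⟨j, l⟩) hy h
  · rfl
  · exact absurd h.symm (key j l hy)
  · exact absurd h (key i k hx)
  · have hl : (l : ℂ) ≠ 0 := by exact_mod_cast (some_mem_triplePoleIndices.mp hy).1
    have hi := hα0 i
    have hj := hα0 j
    simp only [triplePole] at h
    have h3 : (k : ℂ) / l = α i / α j := by
      generalize (2 * (Real.pi : ℂ) * Complex.I) = c at *
      field_simp at h ⊢
      linear_combination h
    have hij : i = j := by
      by_contra hij
      apply hα i j hij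
      rw [← h3]
      have : ((k : ℂ) / l) = ((k / l : ℝ) : ℂ) := by push_cast; rfl
      rw [this, Complex.ofReal_im]
    subst hij
    rw [div_self hi, div_eq_one_iff_eq hl] at h3
    have : k = l := by exact_mod_cast h3
    rw [this]

theorem norm_triplePole (i : Fin 3) (k : ℤ) :
    ‖triplePole α (some ⟨i, k⟩)‖ = |(k : ℝ)| * (2 * Real.pi) / ‖α i‖ := by
  simp [triplePole, abs_of_pos Real.pi_pos]

/-- The condition on `R` keeps the poles off the circle. At `0` only the coefficient of `t⁻¹`
survives, and `2πi / 3! = πi / 3`. -/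
theorem circleIntegral_tripleIntegrand (hα : ∀ i j, i ≠ j → (α i / α j).im ≠ 0) {R : ℝ}
    (hR : 0 < R) (hRα : ∀ i, ∀ k : ℤ, R * (‖α i‖ / (2 * Real.pi)) ≠ k) :
    (∮ t in C(0, R), tripleIntegrand α z t) =
      Real.pi * Complex.I / 3 * iteratedDeriv 3 (tripleGenerating α z) 0 +
        ∑ i, ∑ k ∈ Finset.Icc (-⌊R * (‖α i‖ / (2 * Real.pi))⌋) ⌊R * (‖α i‖ / (2 * Real.pi))⌋,
          tripleResidue α z i k := by
  classical
  have hα0 := ne_zero_of_im_div_ne_zero hα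
  have hpi := Real.pi_pos
  have h2 := Complex.two_pi_I_ne_zero
  have hlt : ∀ x ∈ triplePoleIndices α R, ‖triplePole α x‖ < R := by
    rintro (_ | ⟨i, k⟩) hx
    · simpa [triplePole] using hR
    · have h := (some_mem_triplePoleIndices.mp hx).2
      have h' : |(k : ℝ)| ≠ R * (‖α i‖ / (2 * Real.pi)) := by
        intro h
        apply hRα i |k|
        rw [← h, Int.cast_abs]
      have := lt_of_le_of_ne h h'
      rw [norm_triplePole, div_lt_iff₀ (norm_pos_iff.mpr (hα0 i))]
      rw [← mul_div_assoc, lt_div_iff₀ (by positivity)] at this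
      exact this
  have hne : ∀ x ∈ triplePoleIndices α R, ∀ t ∈ sphere (0 : ℂ) R, t ≠ triplePole α x := by
    rintro x hx t ht rfl
    have := hlt x hx
    simp at ht
    linarith
  rw [circleIntegral_eq_sum_of_principalParts (triplePoleIndices α R) (triplePole α)
    (triplePole_injOn hα R)
    (fun x t => match x with
      | none => ∑ m ∈ Finset.range 4, iteratedDeriv m (tripleGenerating α z) 0 / m.factorial *
        t ^ ((m : ℤ) - 4)
      | some ⟨i, k⟩ => tripleResidue α z i k / (2 * Real.pi * Complex.I) *
          (t - triplePole α (some ⟨i, k⟩))⁻¹)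
    (fun x => match x with
      | none => Real.pi * Complex.I / 3 * iteratedDeriv 3 (tripleGenerating α z) 0
      | some ⟨i, k⟩ => tripleResidue α z i k) hR _ hlt]
  · rw [triplePoleIndices, Finset.sum_insertNone, Finset.sum_sigma]
    congr 1
    refine Finset.sum_congr rfl fun i _ => ?_
    -- The index `k = 0` may be restored, since `tripleResidue` vanishes there by `0⁻¹ = 0`.
    exact Finset.sum_erase _ (by simp [tripleResidue])
  · intro t ht h
    refine tripleIntegrand_analyticAt (h none (by simp [triplePoleIndices])) fun i hi => ?_
    obtain ⟨k, hk⟩ := Complex.exp_eq_one_iff.mp hi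
    have hp : t = triplePole α (some ⟨i, k⟩) := by
      rw [triplePole, eq_div_iff (hα0 i), mul_comm, hk]
    have hk0 : k ≠ 0 := by
      rintro rfl
      apply h none (by simp [triplePoleIndices])
      rw [hp]; simp [triplePole]
    refine h _ (some_mem_triplePoleIndices.mpr ⟨hk0, ?_⟩) hp
    have htR : ‖t‖ ≤ R := by simpa using ht
    rw [hp, norm_triplePole, div_le_iff₀ (norm_pos_iff.mpr (hα0 i))] at htR
    rw [← mul_div_assoc, le_div_iff₀ (by positivity)]
    exact htR
  · rintro (_ | ⟨i, k⟩) hx t ht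
    · refine Finset.analyticAt_fun_sum _ fun m _ => analyticAt_const.mul ?_
      exact analyticAt_id.zpow ht
    · exact analyticAt_const.mul ((analyticAt_id.sub analyticAt_const).inv (sub_ne_zero.mpr ht))
  · rintro (_ | ⟨i, k⟩) hx
    · have hint : ∀ m ∈ Finset.range 4, CircleIntegrable (fun t : ℂ =>
          iteratedDeriv m (tripleGenerating α z) 0 / m.factorial * t ^ ((m : ℤ) - 4)) 0 R := by
        intro m _
        refine ContinuousOn.circleIntegrable hR.le (continuousOn_const.mul ?_)
        exact continuousOn_id.zpow₀ _ fun t ht => Or.inl (hne none hx t ht)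
      have hz : ∀ n : ℤ, n ≠ -1 → (∮ t in C(0, R), t ^ n) = 0 := fun n hn => by
        simpa using circleIntegral.integral_sub_zpow_of_ne hn 0 0 R
      have h1 : (∮ t in C(0, R), t ^ (-1 : ℤ)) = 2 * Real.pi * Complex.I := by
        simpa using circleIntegral.integral_sub_center_inv 0 hR.ne'
      simp only
      rw [circleIntegral.integral_fun_sum hint]
      simp only [circleIntegral.integral_const_mul, Finset.sum_range_succ, Finset.sum_range_zero]
      rw [hz _ (show ((0 : ℕ) : ℤ) - 4 ≠ -1 by norm_num),
        hz _ (show ((1 : ℕ) : ℤ) - 4 ≠ -1 by norm_num),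
        hz _ (show ((2 : ℕ) : ℤ) - 4 ≠ -1 by norm_num),
        show ((3 : ℕ) : ℤ) - 4 = -1 by norm_num, h1]
      norm_num [Nat.factorial]
      ring
    · simp only
      rw [circleIntegral.integral_const_mul,
        circleIntegral.integral_sub_inv_of_mem_ball (by simpa using hlt _ hx),
        div_mul_cancel₀ _ h2]
  · rintro (_ | ⟨i, k⟩) hx
    · exact tripleIntegrand_principalPart_zero hα0
    · exact tripleIntegrand_principalPart hα i (some_mem_triplePoleIndices.mp hx).1

/-- Writing `z` as `∑ s i * α i` distributes `exp (z * t)` over the three denominators, so that each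
quotient is bounded and decays in `|(α i * t).re|`. Two of these real parts cannot be small
together, as `α 0 / α 1` is not real. -/
theorem exists_norm_tripleIntegrand_le (hα : ∀ i j, i ≠ j → (α i / α j).im ≠ 0) {s : Fin 3 → ℝ}
    (hs0 : ∀ i, 0 < s i) (hs1 : ∀ i, s i < 1) (hz : z = ∑ i, s i * α i) {ε : ℝ} (hε : 0 < ε) :
    ∃ C, ∃ δ > 0, ∀ R > 0, (∀ i, ∀ k : ℤ, ε ≤ |R * (‖α i‖ / (2 * Real.pi)) - k|) →
      ∀ t ∈ sphere (0 : ℂ) R, ‖tripleIntegrand α z t‖ ≤ C * Real.exp (-(δ * R)) / R := by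
  have hpi := Real.pi_pos
  obtain ⟨c, hc, hcw⟩ := Complex.exists_le_norm_exp_sub_one
    (η := 2 * Real.pi * ε) (by positivity)
  obtain ⟨κ, hκ, hκt⟩ := Complex.exists_le_abs_re_add_abs_re (hα 0 1 (by simp))
  set m : Fin 3 → ℝ := fun i => min (s i) (1 - s i) with hm
  have hm0 : ∀ i, 0 < m i := fun i => lt_min (hs0 i) (by linarith [hs1 i])
  refine ⟨c⁻¹ ^ 3, min (m 0) (m 1) * κ, mul_pos (lt_min (hm0 0) (hm0 1)) hκ,
    fun R hR hRε t ht => ?_⟩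
  have htR : ‖t‖ = R := by simpa using ht
  have hdist : ∀ i, ∀ k : ℤ, 2 * Real.pi * ε ≤ ‖α i * t - k * (2 * Real.pi * Complex.I)‖ := by
    intro i k
    have h1 := abs_norm_sub_norm_le (α i * t) (k * (2 * Real.pi * Complex.I))
    refine le_trans ?_ h1
    have h2 : ‖(k : ℂ) * (2 * Real.pi * Complex.I)‖ = 2 * Real.pi * ((|k| : ℤ) : ℝ) := by
      simp [abs_of_pos hpi]; ring
    have h3 := hRε i |k|
    rw [h2, norm_mul, htR, show ‖α i‖ * R - 2 * Real.pi * ((|k| : ℤ) : ℝ) =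
      2 * Real.pi * (R * (‖α i‖ / (2 * Real.pi)) - ((|k| : ℤ) : ℝ)) by field_simp,
      abs_mul, abs_of_pos (show 0 < 2 * Real.pi by positivity)]
    gcongr
  have hfac : ∀ i, ‖Complex.exp (s i * (α i * t)) / (Complex.exp (α i * t) - 1)‖ ≤
      c⁻¹ * Real.exp (-(m i * |(α i * t).re|)) := by
    intro i
    refine Complex.norm_exp_div_exp_sub_one_le hc (hcw _ (hdist i)) (hcw _ fun k => ?_)
    have := hdist i (-k)
    rwa [← norm_neg, show -(α i * t - ((-k : ℤ) : ℂ) * (2 * Real.pi * Complex.I)) =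
      -(α i * t) - k * (2 * Real.pi * Complex.I) by push_cast; ring] at this
  have hprod : tripleIntegrand α z t =
      t⁻¹ * ∏ i, (Complex.exp (s i * (α i * t)) / (Complex.exp (α i * t) - 1)) := by
    rw [tripleIntegrand, Finset.prod_div_distrib, ← Complex.exp_sum, hz, Finset.sum_mul,
      mul_comm t, ← div_div, div_eq_mul_inv _ t, mul_comm t⁻¹]
    simp only [mul_assoc]
  rw [hprod, norm_mul, norm_inv, htR, norm_prod, mul_comm, ← div_eq_mul_inv]
  gcongr
  calc ∏ i, ‖Complex.exp (s i * (α i * t)) / (Complex.exp (α i * t) - 1)‖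
      ≤ ∏ i, c⁻¹ * Real.exp (-(m i * |(α i * t).re|)) :=
        Finset.prod_le_prod (fun i _ => norm_nonneg _) fun i _ => hfac i
    _ = c⁻¹ ^ 3 * Real.exp (∑ i, -(m i * |(α i * t).re|)) := by
        rw [Finset.prod_mul_distrib, Real.exp_sum]; simp
    _ ≤ _ := by
        gcongr
        rw [Fin.sum_univ_three]
        have h1 := hκt t
        rw [htR] at h1
        have h2 : min (m 0) (m 1) * |(α 0 * t).re| ≤ m 0 * |(α 0 * t).re| := by
          gcongr; exact min_le_left _ _
        have h3 : min (m 0) (m 1) * |(α 1 * t).re| ≤ m 1 * |(α 1 * t).re| := by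
          gcongr; exact min_le_right _ _
        have h4 : 0 ≤ m 2 * |(α 2 * t).re| := mul_nonneg (hm0 2).le (abs_nonneg _)
        have h5 := mul_le_mul_of_nonneg_left h1 (lt_min (hm0 0) (hm0 1)).le
        linarith

/-- The residues of `tripleIntegrand` add up to zero. -/
theorem tripleResidue_sum_eq_zero (hα : ∀ i j, i ≠ j → (α i / α j).im ≠ 0) {s : Fin 3 → ℝ}
    (hs0 : ∀ i, 0 < s i) (hs1 : ∀ i, s i < 1) (hz : z = ∑ i, s i * α i) {σ : Fin 3 → ℂ}
    (hσ : ∀ i, HasSum (tripleResidue α z i) (σ i)) :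
    Real.pi * Complex.I / 3 * iteratedDeriv 3 (tripleGenerating α z) 0 + ∑ i, σ i = 0 := by
  have hpi := Real.pi_pos
  have hα0 := ne_zero_of_im_div_ne_zero hα
  obtain ⟨ε, hε, hεR⟩ := exists_ge_away_from_int (fun i => ‖α i‖ / (2 * Real.pi))
    fun i => div_pos (norm_pos_iff.mpr (hα0 i)) (by positivity)
  obtain ⟨C, δ, hδ, hC⟩ := exists_norm_tripleIntegrand_le hα hs0 hs1 hz hε
  choose R hRn hRε using fun n : ℕ => hεR (n + 1)
  have hR0 : ∀ n, 0 < R n := fun n => by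
    have := hRn n
    have : (0 : ℝ) ≤ n := n.cast_nonneg
    linarith
  have hRtop : Tendsto R atTop atTop :=
    tendsto_atTop_mono (fun n => (by linarith [hRn n] : (n : ℝ) ≤ R n)) tendsto_natCast_atTop_atTop
  have h1 : Tendsto (fun n => ∮ t in C(0, R n), tripleIntegrand α z t) atTop
      (𝓝 (Real.pi * Complex.I / 3 * iteratedDeriv 3 (tripleGenerating α z) 0 + ∑ i, σ i)) := by
    have h : ∀ n, (∮ t in C(0, R n), tripleIntegrand α z t) = _ := fun n =>
      circleIntegral_tripleIntegrand hα (hR0 n) fun i k h => by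
        have := hRε n i k
        rw [h, sub_self, abs_zero] at this
        linarith
    simp only [h]
    refine tendsto_const_nhds.add (tendsto_finsetSum _ fun i _ => ?_)
    refine (hσ i).comp (Finset.tendsto_Icc_neg_atTop_atTop.comp
      (tendsto_floor_atTop.comp (hRtop.atTop_mul_const ?_)))
    exact div_pos (norm_pos_iff.mpr (hα0 i)) (by positivity)
  refine tendsto_nhds_unique h1 (squeeze_zero_norm (a := fun n =>
    2 * Real.pi * C * Real.exp (-(δ * R n))) (fun n => ?_) ?_)
  · refine (circleIntegral.norm_integral_le_of_norm_le_const (hR0 n).le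
      (hC (R n) (hR0 n) (hRε n))).trans_eq ?_
    have := (hR0 n).ne'
    field_simp
  · have := (Real.tendsto_exp_neg_atTop_nhds_zero.comp (hRtop.const_mul_atTop hδ)).const_mul
      (2 * Real.pi * C)
    simpa using this

end ContourIntegral

/-! ### Infinite products as exponentials of power sums -/

section InfiniteProducts

variable {ι : Type*} {c : ι → ℂ}

theorem multipliable_one_sub_mul (hc : Summable c) (x : ℂ) :
    Multipliable fun i => 1 - x * c i := by
  have := multipliable_one_add_of_summable (f := fun i => -(x * c i)) (by
    simpa using (hc.norm.mul_left ‖x‖))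
  simpa [sub_eq_add_neg] using this

theorem differentiable_tprod_one_sub_mul (hc : Summable c) :
    Differentiable ℂ fun x => ∏' i, (1 - x * c i) := by
  intro x
  have h := Summable.hasProdLocallyUniformlyOn_one_add (f := fun i (x : ℂ) => -(x * c i))
    (K := ball (0 : ℂ) (‖x‖ + 1)) isOpen_ball (hc.norm.mul_left (‖x‖ + 1))
    (Eventually.of_forall fun i y hy => by
      have hy : ‖y‖ < ‖x‖ + 1 := by simpa using hy
      rw [norm_neg, norm_mul]
      gcongr) (fun i => by fun_prop)
  rw [hasProdLocallyUniformlyOn_iff_tendstoLocallyUniformlyOn] at h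
  have hd := h.differentiableOn (Eventually.of_forall fun s => by
    refine DifferentiableOn.fun_finsetProd fun i _ => ?_
    fun_prop) isOpen_ball
  simp only [← sub_eq_add_neg] at hd
  exact hd.differentiableAt (isOpen_ball.mem_nhds (by simp))

/-- The logarithm of an infinite product in terms of power sums. -/
theorem exists_hasSum_powerSum_tprod_eq (hc : Summable c) {x : ℂ} (hx : ∀ i, ‖x * c i‖ < 1)
    {P : ℕ → ℂ} (hP : ∀ k, k ≠ 0 → HasSum (fun i => c i ^ k) (P k)) :
    ∃ S, HasSum (fun k : ℕ => x ^ k / k * P k) S ∧ ∏' i, (1 - x * c i) = Complex.exp (-S) := by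
  have hlog : ∀ i, HasSum (fun k : ℕ => (x * c i) ^ k / k) (-Complex.log (1 - x * c i)) :=
    fun i => Complex.hasSum_taylorSeries_neg_log (hx i)
  have hxc : Summable fun i => -(x * c i) := (hc.mul_left x).neg
  -- Absolute convergence of the double series, which justifies exchanging the sum over the factors
  -- with the Taylor series of the logarithm.
  have hsum : Summable fun p : ι × ℕ => (x * c p.1) ^ p.2 / (p.2 : ℂ) := by
    apply Summable.of_norm
    have hreal : ∀ i, HasSum (fun k : ℕ => ‖(x * c i) ^ k / (k : ℂ)‖)
        (-Real.log (1 - ‖x * c i‖)) := by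
      intro i
      have h := Complex.hasSum_taylorSeries_neg_log (z := (‖x * c i‖ : ℂ)) (by simpa using hx i)
      have h1 : (0 : ℝ) ≤ 1 - ‖x * c i‖ := by linarith [hx i]
      have h2 : -Complex.log (1 - (‖x * c i‖ : ℂ)) = ((-Real.log (1 - ‖x * c i‖) : ℝ) : ℂ) := by
        push_cast [Complex.ofReal_log h1]; rfl
      rw [h2] at h
      refine Complex.hasSum_ofReal.mp (h.congr_fun ?_)
      intro k
      push_cast [norm_div, norm_pow]
      simp
    rw [summable_prod_of_nonneg fun p => norm_nonneg _]
    refine ⟨fun i => (hreal i).summable, ?_⟩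
    simp only [fun i => (hreal i).tsum_eq]
    have := Real.summable_log_one_add_of_summable (f := fun i => -‖x * c i‖)
      (by simpa using (hc.mul_left x).norm.neg)
    simpa [sub_eq_add_neg] using this.neg
  obtain ⟨S, hS⟩ := hsum
  refine ⟨S, ?_, ?_⟩
  · have hS' := (Equiv.prodComm ℕ ι).hasSum_iff.mpr hS
    refine hS'.prod_fiberwise fun k => ?_
    -- Division by zero makes the term `k = 0` vanish, so no value of `P 0` is needed.
    rcases eq_or_ne k 0 with rfl | hk
    · simp
    · refine ((hP k hk).mul_left (x ^ k / k)).congr_fun fun i => ?_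
      simp [mul_pow]; ring
  · have h1 := (hS.prod_fiberwise hlog).tsum_eq
    have hl : Summable fun i => Complex.log (1 - x * c i) := by
      simpa [sub_eq_add_neg] using Complex.summable_log_one_add_of_summable hxc
    rw [← h1, tsum_neg, neg_neg, Complex.cexp_tsum_eq_tprod _ hl]
    intro i h
    have := hx i
    rw [← sub_eq_zero.mp h] at this
    simp at this

end InfiniteProducts

/-! ### The `q`-factorials -/

section QFactorial

theorem hasSum_mul_geometric {x y : ℂ} (hx : ‖x‖ < 1) (hy : ‖y‖ < 1) :
    HasSum (fun p : ℕ × ℕ => x ^ p.1 * y ^ p.2) ((1 - x)⁻¹ * (1 - y)⁻¹) :=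
  (hasSum_geometric_of_norm_lt_one hx).mul (hasSum_geometric_of_norm_lt_one hy)
    (summable_mul_of_summable_norm (by simpa using summable_geometric_of_lt_one (norm_nonneg _) hx)
      (by simpa using summable_geometric_of_lt_one (norm_nonneg _) hy))

theorem hasSum_two_geometric {a b : ℂ} (ha : ‖a‖ < 1) (hb : ‖b‖ < 1) :
    HasSum (fun j : Fin 2 → ℕ => a ^ j 0 * b ^ j 1) ((1 - a)⁻¹ * (1 - b)⁻¹) := by
  exact (finTwoArrowEquiv ℕ).hasSum_iff.mpr (hasSum_mul_geometric ha hb)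

open Classical in
/-- The coefficients in the product `ConeGamma.qFactorial`. -/
noncomputable def qCoeff (q : Fin 2 → ℂ) (j : Fin 2 → ℕ) : ℂ :=
  ∏ i, if 1 < ‖q i‖ then (q i)⁻¹ ^ (j i + 1) else q i ^ j i

open Classical in
theorem qFactorial_def (x : ℂ) (q : Fin 2 → ℂ) : ConeGamma.qFactorial x q =
    (∏' j, (1 - x * qCoeff q j)) ^
      ((-1 : ℤ) ^ (Finset.univ.filter fun i => 1 < ‖q i‖).card) := rfl

open Classical in
-- For `‖q‖ > 1` the series of `q ^ (-(n + 1) * k)` sums to `-(1 - q ^ k)⁻¹`: the same rational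
-- function as inside the disc, up to sign. The exponent in `qFactorial` cancels these signs, so one
-- formula serves all regimes.
theorem hasSum_qCoeff_pow {q : Fin 2 → ℂ} (hq : ∀ i, ‖q i‖ ≠ 1) {k : ℕ} (hk : k ≠ 0) :
    HasSum (fun j => qCoeff q j ^ k) ((-1) ^ (Finset.univ.filter fun i => 1 < ‖q i‖).card *
      ∏ i, (1 - q i ^ k)⁻¹) := by
  have key : ∀ i, ∃ r s : ℂ, ‖r‖ < 1 ∧
      (∀ n : ℕ, (if 1 < ‖q i‖ then (q i)⁻¹ ^ (n + 1) else q i ^ n) ^ k = s * r ^ n) ∧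
      s * (1 - r)⁻¹ = (if 1 < ‖q i‖ then -1 else 1) * (1 - q i ^ k)⁻¹ := by
    intro i
    by_cases h : 1 < ‖q i‖
    · have h0 : q i ≠ 0 := by rintro h0; simp [h0] at h; linarith
      refine ⟨(q i ^ k)⁻¹, (q i ^ k)⁻¹, ?_, fun n => ?_, ?_⟩
      · rw [norm_inv, norm_pow]
        exact inv_lt_one_of_one_lt₀ (one_lt_pow₀ h hk)
      · simp only [h, if_true]; ring
      · have h1 : q i ^ k ≠ 0 := pow_ne_zero _ h0
        simp only [h, if_true]
        rw [← mul_inv, mul_sub, mul_one, mul_inv_cancel₀ h1, ← neg_sub, inv_neg, neg_one_mul]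
    · have h' : ‖q i‖ < 1 := lt_of_le_of_ne (not_lt.mp h) (hq i)
      refine ⟨q i ^ k, 1, ?_, fun n => ?_, ?_⟩
      · rw [norm_pow]; exact pow_lt_one₀ (norm_nonneg _) h' hk
      · simp only [h, if_false]; ring
      · simp [h]
  choose r s hr hrs hs using key
  have h := (hasSum_two_geometric (hr 0) (hr 1)).mul_left (s 0 * s 1)
  rw [mul_mul_mul_comm, hs 0, hs 1] at h
  have hfun : (fun j => qCoeff q j ^ k) = fun j => s 0 * s 1 * (r 0 ^ j 0 * r 1 ^ j 1) := by
    ext j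
    simp only [qCoeff, Fin.prod_univ_two, mul_pow, hrs]
    ring
  have hcard : ((-1 : ℂ) ^ (Finset.univ.filter fun i => 1 < ‖q i‖).card) =
      (if 1 < ‖q 0‖ then -1 else 1) * (if 1 < ‖q 1‖ then -1 else 1) := by
    rw [← Fin.prod_univ_two (fun i => if 1 < ‖q i‖ then (-1 : ℂ) else 1), Finset.prod_ite]
    simp
  rw [hfun, hcard, Fin.prod_univ_two, mul_mul_mul_comm]
  exact h

theorem summable_qCoeff {q : Fin 2 → ℂ} (hq : ∀ i, ‖q i‖ ≠ 1) : Summable (qCoeff q) := by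
  simpa using (hasSum_qCoeff_pow hq one_ne_zero).summable

theorem norm_qCoeff_le (q : Fin 2 → ℂ) (j : Fin 2 → ℕ) :
    ‖qCoeff q j‖ ≤ (∏ i, max 1 ‖q i‖)⁻¹ := by
  rw [qCoeff, norm_prod, ← Finset.prod_inv_distrib]
  refine Finset.prod_le_prod (fun i _ => norm_nonneg _) fun i _ => ?_
  split_ifs with h
  · rw [max_eq_right h.le, norm_pow, norm_inv, pow_succ]
    exact mul_le_of_le_one_left (by positivity)
      (pow_le_one₀ (by positivity) (inv_le_one_of_one_le₀ h.le))
  · rw [max_eq_left (not_lt.mp h), norm_pow, inv_one]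
    exact pow_le_one₀ (norm_nonneg _) (not_lt.mp h)

/-- The bound on `x` puts every `x * qCoeff q j` in the unit disc, where the logarithmic series is
available. -/
theorem qFactorial_eq_exp {q : Fin 2 → ℂ} (hq : ∀ i, ‖q i‖ ≠ 1) {x : ℂ}
    (hx : ‖x‖ < ∏ i, max 1 ‖q i‖) :
    ∃ S, HasSum (fun k : ℕ => x ^ k / k * ∏ i, (1 - q i ^ k)⁻¹) S ∧
      ConeGamma.qFactorial x q = Complex.exp (-S) := by
  classical
  have hpos : 0 < ∏ i, max 1 ‖q i‖ := Finset.prod_pos fun i _ => by positivity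
  obtain ⟨S, hS, h⟩ := exists_hasSum_powerSum_tprod_eq (summable_qCoeff hq) (x := x) (fun j => by
      rw [norm_mul]
      calc ‖x‖ * ‖qCoeff q j‖ ≤ ‖x‖ * (∏ i, max 1 ‖q i‖)⁻¹ := by
            gcongr; exact norm_qCoeff_le q j
        _ < 1 := by rwa [← div_eq_mul_inv, div_lt_one hpos])
    (fun k hk => hasSum_qCoeff_pow hq hk)
  rw [qFactorial_def, h]
  generalize (Finset.univ.filter fun i => 1 < ‖q i‖).card = N at hS
  refine ⟨(-1) ^ N * S, ?_, ?_⟩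
  · refine (hS.mul_left ((-1) ^ N)).congr_fun fun k => ?_
    have : ((-1 : ℂ) ^ N) * (-1) ^ N = 1 := by rw [← mul_pow]; simp
    linear_combination (-(x ^ k / k * ∏ i, (1 - q i ^ k)⁻¹)) * this
  · rcases neg_one_pow_eq_or ℤ N with h | h <;> rcases neg_one_pow_eq_or ℂ N with h' | h'
    all_goals have h2 := congrArg (Int.cast : ℤ → ℂ) h
    all_goals push_cast at h2
    all_goals rw [h'] at h2 ⊢
    all_goals first
      | (exfalso; norm_num at h2; done)
      | (rw [h]; simp [Complex.exp_neg])

theorem meromorphic_qFactorial {q : Fin 2 → ℂ} (hq : ∀ i, ‖q i‖ ≠ 1) :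
    Meromorphic fun x => ConeGamma.qFactorial x q := by
  intro x
  have h := ((differentiable_tprod_one_sub_mul (summable_qCoeff hq)).analyticAt x).meromorphicAt
  exact h.zpow _

end QFactorial

/-! ### The logarithm of the elliptic gamma function as a bilateral series -/

theorem ConeGamma.e_ne_zero (z : ℂ) : e z ≠ 0 := Complex.exp_ne_zero _

theorem ConeGamma.e_add (z w : ℂ) : e (z + w) = e z * e w := by
  rw [e, e, e, mul_add, Complex.exp_add]

theorem ConeGamma.e_neg (z : ℂ) : e (-z) = (e z)⁻¹ := by
  rw [e, e, mul_neg, Complex.exp_neg]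

theorem ConeGamma.e_natCast_mul (k : ℕ) (z : ℂ) : e (k * z) = e z ^ k := by
  rw [e, e, ← Complex.exp_nat_mul]
  ring_nf

theorem ConeGamma.e_intCast (k : ℤ) : e k = 1 := by
  rw [e, mul_comm, Complex.exp_int_mul_two_pi_mul_I]

theorem ConeGamma.norm_e (z : ℂ) : ‖e z‖ = Real.exp (-(2 * Real.pi * z.im)) := by
  rw [e, Complex.norm_exp]
  congr 1
  simp [mul_assoc]

theorem ConeGamma.norm_e_ne_one {z : ℂ} (hz : z.im ≠ 0) : ‖e z‖ ≠ 1 := by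
  rw [norm_e, Ne, Real.exp_eq_one_iff]
  simp [hz, Real.pi_ne_zero]

theorem ConeGamma.e_intCast_mul_ne_one {z : ℂ} (hz : z.im ≠ 0) {k : ℤ} (hk : k ≠ 0) :
    e (k * z) ≠ 1 := by
  intro h
  refine norm_e_ne_one (z := k * z) ?_ (by rw [h, norm_one])
  rw [← Complex.ofReal_intCast, Complex.im_ofReal_mul]
  exact mul_ne_zero (by exact_mod_cast hk) hz

/-- The terms of the bilateral series for the logarithm of the elliptic gamma function. -/
noncomputable def gammaTerm (z τ σ : ℂ) (k : ℤ) : ℂ :=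
  (k : ℂ)⁻¹ * ConeGamma.e (k * z) *
    ((ConeGamma.e (k * τ) - 1)⁻¹ * (ConeGamma.e (k * σ) - 1)⁻¹)

theorem gammaTerm_comm (z τ σ : ℂ) : gammaTerm z τ σ = gammaTerm z σ τ := by
  ext k; simp only [gammaTerm]; ring

theorem gammaTerm_neg (z τ σ : ℂ) (k : ℤ) : gammaTerm (-z) (-τ) (-σ) k = -gammaTerm z τ σ (-k) := by
  simp only [gammaTerm]
  push_cast
  simp only [neg_mul, mul_neg, inv_neg, neg_neg]

theorem gammaTerm_natCast (z τ σ : ℂ) (k : ℕ) : gammaTerm z τ σ k =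
    ConeGamma.e z ^ k / k * ((1 - ConeGamma.e τ ^ k)⁻¹ * (1 - ConeGamma.e σ ^ k)⁻¹) := by
  simp only [gammaTerm, Int.cast_natCast, ConeGamma.e_natCast_mul]
  rw [← neg_sub 1, ← neg_sub 1 (ConeGamma.e σ ^ k), inv_neg, inv_neg]
  ring

/-- The terms of negative index are those of the numerator of `G_1`, whose argument is `τ + σ - z`.
-/
theorem gammaTerm_neg_natCast (z τ σ : ℂ) (k : ℕ) : gammaTerm z τ σ (-k) =
    -((ConeGamma.e (τ + σ - z)) ^ k / k *
      ((1 - ConeGamma.e τ ^ k)⁻¹ * (1 - ConeGamma.e σ ^ k)⁻¹)) := by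
  have h : ∀ w : ℂ, ConeGamma.e (((-(k : ℤ) : ℤ) : ℂ) * w) = (ConeGamma.e w ^ k)⁻¹ := by
    intro w
    rw [← ConeGamma.e_natCast_mul, ← ConeGamma.e_neg]
    push_cast; ring_nf
  have h2 : ∀ x : ℂ, x ≠ 0 → (x⁻¹ - 1)⁻¹ = x * (1 - x)⁻¹ := by
    intro x hx
    rw [show x⁻¹ - 1 = (1 - x) / x by field_simp, inv_div, div_eq_mul_inv]
  simp only [gammaTerm, h]
  rw [h2 _ (pow_ne_zero _ (ConeGamma.e_ne_zero _)), h2 _ (pow_ne_zero _ (ConeGamma.e_ne_zero _)),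
    show τ + σ - z = τ + σ + -z by ring, ConeGamma.e_add, ConeGamma.e_add, ConeGamma.e_neg]
  push_cast
  rw [inv_neg, mul_pow, mul_pow, inv_pow]
  ring

/-- `exp` of the sum of `gammaTerm` is the ratio of the two infinite products defining an elliptic
gamma function, once these are known in the unit disc. -/
theorem hasSum_gammaTerm {z τ σ A B : ℂ}
    (hA : HasSum (fun k : ℕ => ConeGamma.e z ^ k / k *
      ((1 - ConeGamma.e τ ^ k)⁻¹ * (1 - ConeGamma.e σ ^ k)⁻¹)) A)
    (hB : HasSum (fun k : ℕ => ConeGamma.e (τ + σ - z) ^ k / k *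
      ((1 - ConeGamma.e τ ^ k)⁻¹ * (1 - ConeGamma.e σ ^ k)⁻¹)) B) :
    HasSum (gammaTerm z τ σ) (A - B) := by
  have h1 : HasSum (fun k : ℕ => gammaTerm z τ σ k) A := by simpa only [gammaTerm_natCast] using hA
  have h2 : HasSum (fun k : ℕ => gammaTerm z τ σ (-k)) (-B) := by
    simpa only [gammaTerm_neg_natCast] using hB.neg
  have := HasSum.of_nat_of_neg h1 h2
  rwa [show gammaTerm z τ σ 0 = 0 by simp [gammaTerm], sub_zero, ← sub_eq_add_neg] at this

/-- For `y ≠ 0` and `s` in `(0, 1)`, `exp(-2π s y)` is strictly below the larger of its values at `s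
= 0` and `s = 1`. This is independent of the signs of the imaginary parts. -/
theorem ConeGamma.norm_e_lt_prod_max {z τ σ : ℂ} (hτ : τ.im ≠ 0) (hσ : σ.im ≠ 0) {s u : ℝ}
    (hs : s ∈ Set.Ioo (0 : ℝ) 1) (hu : u ∈ Set.Ioo (0 : ℝ) 1) (hz : z.im = s * τ.im + u * σ.im) :
    ‖e z‖ < max 1 ‖e τ‖ * max 1 ‖e σ‖ := by
  have key : ∀ (y s : ℝ), y ≠ 0 → s ∈ Set.Ioo (0 : ℝ) 1 →
      Real.exp (-(2 * Real.pi * (s * y))) < max 1 (Real.exp (-(2 * Real.pi * y))) := by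
    intro y s hy hs
    have hpi := Real.pi_pos
    rcases lt_or_gt_of_ne hy with h | h
    · refine lt_max_of_lt_right (Real.exp_lt_exp.mpr ?_)
      have : 0 < (1 - s) * -y := mul_pos (by linarith [hs.2]) (by linarith)
      nlinarith
    · refine lt_max_of_lt_left ?_
      rw [Real.exp_lt_one_iff, neg_lt_zero]
      have := hs.1
      positivity
  rw [norm_e, norm_e, norm_e, hz, show -(2 * Real.pi * (s * τ.im + u * σ.im)) =
    -(2 * Real.pi * (s * τ.im)) + -(2 * Real.pi * (u * σ.im)) by ring, Real.exp_add]
  exact mul_lt_mul'' (key _ _ hτ hs) (key _ _ hσ hu) (Real.exp_pos _).le (Real.exp_pos _).le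

/-- The series for the logarithm of the elliptic gamma function in its fundamental strip. -/
theorem ConeGamma.G_one_eq_exp {z τ σ : ℂ} (hτ : τ.im ≠ 0) (hσ : σ.im ≠ 0) {s u : ℝ}
    (hs : s ∈ Set.Ioo (0 : ℝ) 1) (hu : u ∈ Set.Ioo (0 : ℝ) 1) (hz : z.im = s * τ.im + u * σ.im) :
    ∃ S, HasSum (gammaTerm z τ σ) S ∧ G 1 z ![τ, σ] = Complex.exp S := by
  have hq : ∀ i : Fin 2, ‖(fun j : Fin 2 => e (![τ, σ] j)) i‖ ≠ 1 := by
    intro i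
    fin_cases i
    · exact norm_e_ne_one hτ
    · exact norm_e_ne_one hσ
  have hprod : (e z)⁻¹ * ∏ j : Fin 2, e (![τ, σ] j) = e (τ + σ - z) := by
    rw [Fin.prod_univ_two, sub_eq_add_neg, e_add, e_add, e_neg, mul_comm]
    rfl
  obtain ⟨A, hA, hA'⟩ := qFactorial_eq_exp hq (x := e z) (by
    simpa [Fin.prod_univ_two] using norm_e_lt_prod_max hτ hσ hs hu hz)
  obtain ⟨B, hB, hB'⟩ := qFactorial_eq_exp hq (x := e (τ + σ - z)) (by
    -- The reflection `z ↦ τ + σ - z` preserves the strip, replacing `s`, `u` by `1 - s`, `1 - u`.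
    simpa [Fin.prod_univ_two] using norm_e_lt_prod_max (z := τ + σ - z) hτ hσ
      (s := 1 - s) (u := 1 - u) ⟨by linarith [hs.2], by linarith [hs.1]⟩
      ⟨by linarith [hu.2], by linarith [hu.1]⟩ (by
        rw [Complex.sub_im, Complex.add_im, hz]; ring))
  refine ⟨A - B, hasSum_gammaTerm (by simp only [Fin.prod_univ_two] at hA; exact hA)
    (by simp only [Fin.prod_univ_two] at hB; exact hB), ?_⟩
  rw [G, hprod]
  refine Eq.trans (congrArg₂ (fun a b => a * b ^ ((-1 : ℤ) ^ 1)) hB' hA') ?_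
  rw [pow_one, zpow_neg_one, ← Complex.exp_neg, neg_neg, ← Complex.exp_add]
  ring_nf

theorem ConeGamma.meromorphic_G_one {τ σ : ℂ} (hτ : τ.im ≠ 0) (hσ : σ.im ≠ 0) :
    Meromorphic fun z => G 1 z ![τ, σ] := by
  have hq : ∀ i : Fin 2, ‖(fun j : Fin 2 => e (![τ, σ] j)) i‖ ≠ 1 := by
    intro i
    fin_cases i
    · exact norm_e_ne_one hτ
    · exact norm_e_ne_one hσ
  have he : ∀ z, AnalyticAt ℂ e z := fun z => by unfold e; fun_prop
  intro z
  refine MeromorphicAt.mul ?_ (MeromorphicAt.zpow ?_ _)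
  · exact (meromorphic_qFactorial hq _).comp_analyticAt
      (((he z).inv (e_ne_zero z)).mul analyticAt_const)
  · exact (meromorphic_qFactorial hq _).comp_analyticAt (he z)

theorem tripleResidue_eq_gammaTerm (α : Fin 3 → ℂ) (z : ℂ) :
    tripleResidue α z 0 = gammaTerm (z / α 0) (α 1 / α 0) (α 2 / α 0) ∧
    tripleResidue α z 1 = gammaTerm (z / α 1) (α 0 / α 1) (α 2 / α 1) ∧
    tripleResidue α z 2 = gammaTerm (z / α 2) (α 0 / α 2) (α 1 / α 2) := by
  have h0 : (Finset.univ : Finset (Fin 3)).erase 0 = {1, 2} := by decide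
  have h1 : (Finset.univ : Finset (Fin 3)).erase 1 = {0, 2} := by decide
  have h2 : (Finset.univ : Finset (Fin 3)).erase 2 = {0, 1} := by decide
  refine ⟨?_, ?_, ?_⟩ <;> ext k <;> rw [tripleResidue] <;>
    simp only [h0, h1, h2] <;> rw [Finset.prod_pair (by decide)] <;> rfl

/-- The modular property of the elliptic gamma function, for the series of logarithms. -/
theorem gammaTerm_modular {a c z : ℂ} (ha : a.im ≠ 0) (hc : c.im ≠ 0) (hac : (a / c).im ≠ 0)
    {s : Fin 3 → ℝ} (hs : ∀ i, s i ∈ Set.Ioo (0 : ℝ) 1) (hz : z = s 0 * a + s 1 * c - s 2)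
    {S A C : ℂ} (hS : HasSum (gammaTerm z a c) S)
    (hA : HasSum (gammaTerm (z / a) (-1 / a) (c / a)) A)
    (hC : HasSum (gammaTerm (z / c) (-1 / c) (a / c)) C) :
    S = Real.pi * Complex.I / 3 * iteratedDeriv 3 (tripleGenerating ![a, c, -1] z) 0 + A + C := by
  have hinv : ∀ x : ℂ, x.im ≠ 0 → (x⁻¹).im ≠ 0 := by
    intro x hx
    have hx0 : x ≠ 0 := by rintro rfl; simp at hx
    rw [Complex.inv_im]
    exact div_ne_zero (neg_ne_zero.mpr hx) (by simpa using hx0)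
  have hα : ∀ i j, i ≠ j → (![a, c, -1] i / ![a, c, -1] j).im ≠ 0 := by
    have h1 : (c / a).im ≠ 0 := by rw [← inv_div]; exact hinv _ hac
    have h2 := hinv a ha
    have h3 := hinv c hc
    intro i j hij
    fin_cases i <;> fin_cases j <;> first | exact absurd rfl hij | skip
    · exact hac
    · change (a / -1).im ≠ 0
      rw [div_neg, div_one]; simpa using ha
    · exact h1
    · change (c / -1).im ≠ 0
      rw [div_neg, div_one]; simpa using hc
    · simpa [neg_div] using h2
    · simpa [neg_div] using h3
  obtain ⟨e0, e1, e2⟩ := tripleResidue_eq_gammaTerm ![a, c, -1] z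
  -- The residues at the poles belonging to `-1` have all arguments divided by `-1`; replacing `k`
  -- by `-k` turns them into the negatives of the terms of `S`.
  have hneg : HasSum (fun k => gammaTerm (-z) (-a) (-c) k) (-S) := by
    simp only [gammaTerm_neg]
    exact ((Equiv.neg ℤ).hasSum_iff.mpr hS).neg
  have := tripleResidue_sum_eq_zero hα (s := s) (fun i => (hs i).1) (fun i => (hs i).2)
    (z := z) (by rw [hz, Fin.sum_univ_three]; simp; ring) (σ := ![A, C, -S]) (by
      intro i
      fin_cases i
      · refine e0 ▸ ?_
        rw [gammaTerm_comm]; exact hA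
      · refine e1 ▸ ?_
        rw [gammaTerm_comm]; exact hC
      · refine e2 ▸ ?_
        simpa [div_neg] using hneg)
  rw [Fin.sum_univ_three] at this
  simp only [Matrix.cons_val] at this
  linear_combination -this

/-! ### Interiors of cones, and the rays of a planar cone -/

namespace ConeGamma

section Cones

variable {m : ℕ} {ι : Type} {v : ι → Fin m → ℤ}

theorem toReal_dotProduct_toReal (u w : Fin m → ℤ) : toReal u ⬝ᵥ toReal w = ((u ⬝ᵥ w : ℤ) : ℝ) := by
  simp [dotProduct, toReal]

theorem toReal_dotProduct_self_pos {u : Fin m → ℤ} (hu : u ≠ 0) : 0 < toReal u ⬝ᵥ toReal u := by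
  refine lt_of_le_of_ne (Finset.sum_nonneg fun _ _ => mul_self_nonneg _) fun h => hu ?_
  have := dotProduct_self_eq_zero.mp h.symm
  ext j
  have hj := congrFun this j
  simpa [toReal] using hj

/-- An interior point can be moved slightly along `-v i` without leaving the cone, which forces a
strict inequality. -/
theorem interior_cone [Finite ι] (hv : ∀ i, v i ≠ 0) :
    interior (cone v) = {x | ∀ i, 0 < x ⬝ᵥ toReal (v i)} := by
  apply Set.Subset.antisymm
  · intro x hx i
    have hcont : Tendsto (fun ε : ℝ => x - ε • toReal (v i)) (𝓝[>] 0) (𝓝 x) := by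
      have : Continuous fun ε : ℝ => x - ε • toReal (v i) := by fun_prop
      simpa using (this.tendsto 0).mono_left nhdsWithin_le_nhds
    obtain ⟨ε, hε, hε0⟩ :=
      ((hcont.eventually (mem_interior_iff_mem_nhds.mp hx)).and self_mem_nhdsWithin).exists
    have h := hε i
    rw [sub_dotProduct, smul_dotProduct, smul_eq_mul] at h
    have := mul_pos (show 0 < ε from hε0) (toReal_dotProduct_self_pos (hv i))
    linarith
  · refine interior_maximal (fun x hx i => (hx i).le) ?_
    simp only [Set.ofPred_forall]
    exact isOpen_iInter_of_finite fun i =>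
      isOpen_lt continuous_const (by unfold dotProduct; fun_prop)

theorem mem_latticePoints_cone {p : Fin m → ℤ} :
    p ∈ latticePoints (cone v) ↔ ∀ i, 0 ≤ p ⬝ᵥ v i := by
  simp [latticePoints, cone, toReal_dotProduct_toReal]

theorem mem_latticePoints_interior_cone [Finite ι] (hv : ∀ i, v i ≠ 0) {p : Fin m → ℤ} :
    p ∈ latticePoints (interior (cone v)) ↔ ∀ i, 0 < p ⬝ᵥ v i := by
  simp [latticePoints, interior_cone hv, toReal_dotProduct_toReal]

theorem dotProduct_pos_of_mem_interior_dualCone {C : Set (Fin m → ℝ)} {y u : Fin m → ℝ}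
    (hy : y ∈ interior (dualCone C)) (hu : u ∈ C) (hu0 : u ≠ 0) : 0 < y ⬝ᵥ u := by
  have hcont : Tendsto (fun ε : ℝ => y - ε • u) (𝓝[>] 0) (𝓝 y) := by
    have : Continuous fun ε : ℝ => y - ε • u := by fun_prop
    simpa using (this.tendsto 0).mono_left nhdsWithin_le_nhds
  obtain ⟨ε, hε, hε0⟩ :=
    ((hcont.eventually (mem_interior_iff_mem_nhds.mp hy)).and self_mem_nhdsWithin).exists
  have h := hε u hu
  rw [sub_dotProduct, smul_dotProduct, smul_eq_mul] at h
  have hpos : 0 < u ⬝ᵥ u := lt_of_le_of_ne (Finset.sum_nonneg fun _ _ => mul_self_nonneg _) fun h =>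
    hu0 (dotProduct_self_eq_zero.mp h.symm)
  have := mul_pos (show 0 < ε from hε0) hpos
  linarith

theorem pair_add (p q : Fin m → ℤ) (ω : Fin m → ℂ) : pair (p + q) ω = pair p ω + pair q ω := by
  simp [pair, add_mul, Finset.sum_add_distrib]

theorem pair_zsmul (k : ℤ) (p : Fin m → ℤ) (ω : Fin m → ℂ) : pair (k • p) ω = k * pair p ω := by
  simp [pair, Finset.mul_sum, mul_assoc]

theorem pair_neg (p : Fin m → ℤ) (ω : Fin m → ℂ) : pair (-p) ω = -pair p ω := by
  simp [pair]

theorem pair_im (p : Fin m → ℤ) (ω : Fin m → ℂ) :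
    (pair p ω).im = (fun j => (ω j).im) ⬝ᵥ toReal p := by
  simp [pair, dotProduct, toReal, mul_comm]

end Cones

section Planar

variable {v n : Fin 2 → Fin 2 → ℤ}

/-- The primitive generator of the ray of the cone on the face `f`. -/
noncomputable def ray (v n : Fin 2 → Fin 2 → ℤ) (f : Fin 2) : Fin 2 → ℤ := (columns (n f) (v f))⁻¹ 0

/-- The lattice vector completing `ray v n f` to the basis dual to `n f`, `v f`. -/
noncomputable def corayVec (v n : Fin 2 → Fin 2 → ℤ) (f : Fin 2) : Fin 2 → ℤ :=
  (columns (n f) (v f))⁻¹ 1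

/-- The index of the sublattice spanned by the two rays. -/
noncomputable def coneIndex (v n : Fin 2 → Fin 2 → ℤ) : ℤ := ray v n 0 ⬝ᵥ v 1

/-- The product of `corayVec` with the other normal. -/
noncomputable def corayShift (v n : Fin 2 → Fin 2 → ℤ) (f : Fin 2) : ℤ :=
  corayVec v n f ⬝ᵥ v (1 - f)

theorem isUnit_det_columns (hn : ∀ f, IsFaceVector v f (n f)) (f : Fin 2) :
    IsUnit (columns (n f) (v f)).det :=
  Int.isUnit_iff.mpr (hn f).1

theorem ray_dotProduct (hn : ∀ f, IsFaceVector v f (n f)) (f : Fin 2) :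
    ray v n f ⬝ᵥ n f = 1 ∧ ray v n f ⬝ᵥ v f = 0 ∧
      corayVec v n f ⬝ᵥ n f = 0 ∧ corayVec v n f ⬝ᵥ v f = 1 := by
  have h := Matrix.nonsing_inv_mul _ (isUnit_det_columns hn f)
  refine ⟨?_, ?_, ?_, ?_⟩
  · simpa [Matrix.mul_apply, columns, dotProduct, ray] using congrFun (congrFun h 0) 0
  · simpa [Matrix.mul_apply, columns, dotProduct, ray] using congrFun (congrFun h 0) 1
  · simpa [Matrix.mul_apply, columns, dotProduct, corayVec] using congrFun (congrFun h 1) 0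
  · simpa [Matrix.mul_apply, columns, dotProduct, corayVec] using congrFun (congrFun h 1) 1

theorem eq_ray_add_corayVec (hn : ∀ f, IsFaceVector v f (n f)) (f : Fin 2) (u : Fin 2 → ℤ) :
    u = (u ⬝ᵥ n f) • ray v n f + (u ⬝ᵥ v f) • corayVec v n f := by
  have h := Matrix.mul_nonsing_inv _ (isUnit_det_columns hn f)
  have key : ∀ i j, n f i * ray v n f j + v f i * corayVec v n f j = if i = j then 1 else 0 := by
    intro i j
    have := congrFun (congrFun h i) j
    rw [Matrix.mul_apply, Fin.sum_univ_two, Matrix.one_apply] at this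
    rw [← this, ray, corayVec, columns]
    fin_cases i <;> simp
  ext j
  simp only [dotProduct, Fin.sum_univ_two, Pi.add_apply, Pi.smul_apply, smul_eq_mul]
  have h0 := key 0 j
  have h1 := key 1 j
  fin_cases j
  · simp at h0 h1 ⊢; linear_combination (-u 0) * h0 - u 1 * h1
  · simp at h0 h1 ⊢; linear_combination (-u 0) * h0 - u 1 * h1

theorem ne_zero_of_isFaceVector (hn : ∀ f, IsFaceVector v f (n f)) (f : Fin 2) : v f ≠ 0 := by
  intro h
  have := (ray_dotProduct hn f).2.2.2
  simp [h] at this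

theorem ray_ne_zero (hn : ∀ f, IsFaceVector v f (n f)) (f : Fin 2) : ray v n f ≠ 0 := by
  intro h
  have := (ray_dotProduct hn f).1
  simp [h] at this

/-- Otherwise `-ray v n f` would lie on the face `f` of the cone, although its product with `n f` is
`-1`. The sign condition on `n f` thus makes `ray` point into the cone. -/
theorem ray_dotProduct_other_pos (hn : ∀ f, IsFaceVector v f (n f))
    (f : Fin 2) : 0 < ray v n f ⬝ᵥ v (1 - f) := by
  obtain ⟨h1, h2, -, -⟩ := ray_dotProduct hn f
  have hcone : ∀ u : Fin 2 → ℤ, 0 ≤ u ⬝ᵥ v f → 0 ≤ u ⬝ᵥ v (1 - f) → toReal u ∈ cone v := by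
    intro u hu hu' i
    rw [toReal_dotProduct_toReal]
    have : i = f ∨ i = 1 - f := by fin_cases i <;> fin_cases f <;> simp
    rcases this with rfl | rfl
    · exact_mod_cast hu
    · exact_mod_cast hu'
  have hneg : toReal (-ray v n f) = -toReal (ray v n f) := by ext; simp [toReal]
  by_contra! hle
  have hmem : toReal (-ray v n f) ∈ cone v :=
    hcone _ (by simp [h2]) (by rw [neg_dotProduct]; linarith)
  have hne : toReal (-ray v n f) ≠ 0 := by
    intro h
    apply ray_ne_zero hn f
    ext j
    have := congrFun h j
    simpa [toReal] using this
  have := (hn f).2 _ hmem (by rw [toReal_dotProduct_toReal]; simp [h2]) hne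
  rw [toReal_dotProduct_toReal, dotProduct_comm, neg_dotProduct, h1] at this
  norm_num at this

theorem ray_explicit (hn : ∀ f, IsFaceVector v f (n f)) (f : Fin 2) :
    ray v n f 0 = (columns (n f) (v f)).det * v f 1 ∧
      ray v n f 1 = -((columns (n f) (v f)).det * v f 0) := by
  have hinv : Ring.inverse (columns (n f) (v f)).det = (columns (n f) (v f)).det := by
    rcases (hn f).1 with h | h <;> rw [h]
    · exact Ring.inverse_one ℤ
    · exact Ring.inverse_unit (-1 : ℤˣ)
  constructor
  · rw [ray, Matrix.inv_def, hinv]; simp [Matrix.adjugate_fin_two, columns]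
  · rw [ray, Matrix.inv_def, hinv]; simp [Matrix.adjugate_fin_two, columns]

/-- Both products equal `± det(v 0, v 1)`, and both are positive. -/
theorem ray_dotProduct_other (hn : ∀ f, IsFaceVector v f (n f)) (f : Fin 2) :
    ray v n f ⬝ᵥ v (1 - f) = coneIndex v n := by
  have h0 := ray_dotProduct_other_pos hn 0
  have h1 := ray_dotProduct_other_pos hn 1
  obtain ⟨e0, e0'⟩ := ray_explicit hn 0
  obtain ⟨e1, e1'⟩ := ray_explicit hn 1
  fin_cases f
  · rfl
  · simp only [coneIndex, dotProduct, Fin.sum_univ_two, sub_zero, sub_self, Fin.mk_one, e0, e0', e1,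
      e1'] at h0 h1 ⊢
    rcases (hn 0).1 with d0 | d0 <;> rcases (hn 1).1 with d1 | d1 <;> rw [d0] at h0 ⊢ <;>
      rw [d1] at h1 ⊢ <;> linarith

theorem coneIndex_pos (hn : ∀ f, IsFaceVector v f (n f)) :
    0 < coneIndex v n := ray_dotProduct_other_pos hn 0

/-- The second normal in the basis dual to the first face. -/
theorem dotProduct_other (hn : ∀ f, IsFaceVector v f (n f)) (f : Fin 2)
    (u : Fin 2 → ℤ) :
    u ⬝ᵥ v (1 - f) = (u ⬝ᵥ n f) * coneIndex v n + (u ⬝ᵥ v f) * corayShift v n f := by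
  conv_lhs => rw [eq_ray_add_corayVec hn f u]
  rw [add_dotProduct, smul_dotProduct, smul_dotProduct, ray_dotProduct_other hn f]
  rfl

theorem eq_of_dotProduct_eq (hn : ∀ f, IsFaceVector v f (n f))
    {u w : Fin 2 → ℤ} (h : ∀ f, u ⬝ᵥ v f = w ⬝ᵥ v f) : u = w := by
  have h0 := dotProduct_other hn 0 u
  have h1 := dotProduct_other hn 0 w
  rw [h, h] at h0
  have := coneIndex_pos hn
  have hn0 : u ⬝ᵥ n 0 = w ⬝ᵥ n 0 := by
    apply mul_right_cancel₀ this.ne'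
    linarith
  rw [eq_ray_add_corayVec hn 0 u, eq_ray_add_corayVec hn 0 w, h, hn0]

theorem ray_other (hn : ∀ f, IsFaceVector v f (n f)) (f : Fin 2) :
    ray v n (1 - f) = coneIndex v n • corayVec v n f - corayShift v n f • ray v n f := by
  apply eq_of_dotProduct_eq hn
  have h1 := ray_dotProduct_other hn (1 - f)
  rw [sub_sub_cancel] at h1
  obtain ⟨-, h2, -, h3⟩ := ray_dotProduct hn f
  intro i
  have : i = f ∨ i = 1 - f := by fin_cases i <;> fin_cases f <;> simp
  rcases this with rfl | rfl
  · rw [h1, sub_dotProduct, smul_dotProduct, smul_dotProduct, h2, h3]; simp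
  · have h4 := (ray_dotProduct hn (1 - f)).2.1
    have h5 := ray_dotProduct_other hn f
    rw [h4, sub_dotProduct, smul_dotProduct, smul_dotProduct, h5]
    simp only [smul_eq_mul, corayShift]
    ring

/-- Multiplication by the shift is thereby a permutation of the residues mod `coneIndex v n`, which
relates the two faces' indexings of the fundamental points. -/
theorem corayShift_mul_modEq (hn : ∀ f, IsFaceVector v f (n f)) :
    coneIndex v n ∣ corayShift v n 0 * corayShift v n 1 - 1 := by
  have h := dotProduct_other hn 1 (corayVec v n 0)
  have h3 := (ray_dotProduct hn 0).2.2.2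
  rw [show (1 : Fin 2) - 1 = 0 by rfl, h3] at h
  refine ⟨-(corayVec v n 0 ⬝ᵥ n 1), ?_⟩
  have : corayShift v n 0 = corayVec v n 0 ⬝ᵥ v 1 := rfl
  rw [this]
  linarith

end Planar

end ConeGamma

namespace ConeGamma

/-! ### Lattice points of a planar cone and their exponential sums -/

section LatticeSums

variable {v n : Fin 2 → Fin 2 → ℤ}

/-- The lattice points `p` of the fundamental parallelogram, indexed by `p ⬝ v 0`. -/
noncomputable def fundPoint (v n : Fin 2 → Fin 2 → ℤ) (q : ℤ) : Fin 2 → ℤ :=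
  q • corayVec v n 0 - (q * corayShift v n 0 / coneIndex v n) • ray v n 0

theorem fundPoint_dotProduct_zero (hn : ∀ f, IsFaceVector v f (n f)) (q : ℤ) :
    fundPoint v n q ⬝ᵥ v 0 = q := by
  obtain ⟨-, h2, -, h4⟩ := ray_dotProduct hn 0
  rw [fundPoint, sub_dotProduct, smul_dotProduct, smul_dotProduct, h2, h4]
  simp

theorem fundPoint_dotProduct_one (q : ℤ) :
    fundPoint v n q ⬝ᵥ v 1 = q * corayShift v n 0 % coneIndex v n := by
  rw [fundPoint, sub_dotProduct, smul_dotProduct, smul_dotProduct, Int.emod_def,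
    show corayVec v n 0 ⬝ᵥ v 1 = corayShift v n 0 from rfl,
    show ray v n 0 ⬝ᵥ v 1 = coneIndex v n from rfl]
  simp only [smul_eq_mul]
  ring

/-- The lattice points as translates of the fundamental ones. -/
noncomputable def latticeMap (v n : Fin 2 → Fin 2 → ℤ)
    (x : Fin (coneIndex v n).toNat × ℤ × ℤ) : Fin 2 → ℤ :=
  fundPoint v n (x.1 : ℕ) + (x.2.1 • ray v n 1 + x.2.2 • ray v n 0)

theorem latticeMap_dotProduct (hn : ∀ f, IsFaceVector v f (n f))
    (x : Fin (coneIndex v n).toNat × ℤ × ℤ) :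
    latticeMap v n x ⬝ᵥ v 0 = (x.1 : ℕ) + coneIndex v n * x.2.1 ∧
    latticeMap v n x ⬝ᵥ v 1 =
      (x.1 : ℕ) * corayShift v n 0 % coneIndex v n + coneIndex v n * x.2.2 := by
  have h1 := (ray_dotProduct hn 0).2.1
  have h2 := (ray_dotProduct hn 1).2.1
  have h3 := ray_dotProduct_other hn 0
  have h4 := ray_dotProduct_other hn 1
  rw [sub_zero] at h3
  rw [sub_self] at h4
  constructor <;> simp only [latticeMap, add_dotProduct, smul_dotProduct,
    fundPoint_dotProduct_zero hn, fundPoint_dotProduct_one, h1, h2, h3, h4, smul_eq_mul] <;> ring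

theorem Int.ediv_emod_of_eq_add_mul {N q k a : ℤ} (hq0 : 0 ≤ q) (hq : q < N)
    (h : a = q + N * k) : a / N = k ∧ a % N = q := by
  have hN : N ≠ 0 := by omega
  rw [h, Int.add_mul_ediv_left _ _ hN, Int.add_mul_emod_self_left]
  exact ⟨by rw [Int.ediv_eq_zero_of_lt hq0 hq, zero_add], Int.emod_eq_of_lt hq0 hq⟩

/-- The two translation coordinates are the quotients of `u ⬝ v 0` and `u ⬝ v 1` by the index. The
remainder of `u ⬝ v 1` is no further datum, since it is that of `(u ⬝ v 0) * corayShift v n 0`. -/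
theorem latticeMap_bijective (hn : ∀ f, IsFaceVector v f (n f)) :
    Function.Bijective (latticeMap v n) := by
  have hN := coneIndex_pos hn
  constructor
  · rintro ⟨q, k, l⟩ ⟨q', k', l'⟩ h
    obtain ⟨h0, h1⟩ := latticeMap_dotProduct hn ⟨q, k, l⟩
    obtain ⟨h0', h1'⟩ := latticeMap_dotProduct hn ⟨q', k', l'⟩
    rw [h] at h0 h1
    have hq := q.2
    have hq' := q'.2
    obtain ⟨e1, e2⟩ := Int.ediv_emod_of_eq_add_mul (by positivity) (by simp; omega) h0
    obtain ⟨e1', e2'⟩ := Int.ediv_emod_of_eq_add_mul (by positivity) (by simp; omega) h0'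
    obtain ⟨e3, -⟩ := Int.ediv_emod_of_eq_add_mul (Int.emod_nonneg _ hN.ne')
      (Int.emod_lt_of_pos _ hN) h1
    obtain ⟨e3', -⟩ := Int.ediv_emod_of_eq_add_mul (Int.emod_nonneg _ hN.ne')
      (Int.emod_lt_of_pos _ hN) h1'
    simp only at e1 e1' e2 e2' e3 e3'
    have : q = q' := Fin.ext (by omega)
    simp only [Prod.mk.injEq]
    exact ⟨this, by omega, by omega⟩
  · intro u
    have hq0 := Int.emod_nonneg (u ⬝ᵥ v 0) hN.ne'
    have hq := Int.emod_lt_of_pos (u ⬝ᵥ v 0) hN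
    refine ⟨⟨⟨(u ⬝ᵥ v 0 % coneIndex v n).toNat, by omega⟩, u ⬝ᵥ v 0 / coneIndex v n,
      u ⬝ᵥ v 1 / coneIndex v n⟩, eq_of_dotProduct_eq hn fun f => ?_⟩
    obtain ⟨h0, h1⟩ := latticeMap_dotProduct hn
      ⟨⟨(u ⬝ᵥ v 0 % coneIndex v n).toNat, by omega⟩, u ⬝ᵥ v 0 / coneIndex v n,
      u ⬝ᵥ v 1 / coneIndex v n⟩
    simp only [Int.toNat_of_nonneg hq0] at h0 h1
    fin_cases f
    · exact h0.trans (Int.emod_add_mul_ediv _ _)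
    · refine h1.trans ?_
      have h2 := dotProduct_other hn 0 u
      rw [sub_zero] at h2
      have h3 : (u ⬝ᵥ v 0 % coneIndex v n) * corayShift v n 0 % coneIndex v n =
          u ⬝ᵥ v 1 % coneIndex v n := by
        rw [h2, add_comm, Int.add_mul_emod_self_right]
        exact (Int.mod_modEq _ _).mul_right _
      rw [h3]
      exact Int.emod_add_mul_ediv _ _

theorem latticeMap_mem_cone (hn : ∀ f, IsFaceVector v f (n f))
    (x : Fin (coneIndex v n).toNat × ℤ × ℤ) :
    latticeMap v n x ∈ latticePoints (cone v) ↔ 0 ≤ x.2.1 ∧ 0 ≤ x.2.2 := by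
  have hN := coneIndex_pos hn
  obtain ⟨h0, h1⟩ := latticeMap_dotProduct hn x
  have hq := x.1.2
  obtain ⟨e1, -⟩ := Int.ediv_emod_of_eq_add_mul (by positivity) (by omega) h0
  obtain ⟨e2, -⟩ := Int.ediv_emod_of_eq_add_mul (Int.emod_nonneg _ hN.ne')
    (Int.emod_lt_of_pos _ hN) h1
  rw [mem_latticePoints_cone, Fin.forall_fin_two, ← e1, ← e2, Int.ediv_nonneg_iff_of_pos hN,
    Int.ediv_nonneg_iff_of_pos hN]

/-- Being strictly positive is the negation of being nonnegative after a change of sign, so the same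
representatives describe the interior points after reflection. -/
theorem neg_latticeMap_mem_interior_cone (hn : ∀ f, IsFaceVector v f (n f))
    (x : Fin (coneIndex v n).toNat × ℤ × ℤ) :
    -latticeMap v n x ∈ latticePoints (interior (cone v)) ↔ x.2.1 < 0 ∧ x.2.2 < 0 := by
  have h : ∀ i, 0 < -latticeMap v n x ⬝ᵥ v i ↔ ¬ 0 ≤ latticeMap v n x ⬝ᵥ v i := fun i => by
    rw [neg_dotProduct]; omega
  have hN := coneIndex_pos hn
  obtain ⟨h0, h1⟩ := latticeMap_dotProduct hn x
  have hq := x.1.2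
  obtain ⟨e1, -⟩ := Int.ediv_emod_of_eq_add_mul (by positivity) (by omega) h0
  obtain ⟨e2, -⟩ := Int.ediv_emod_of_eq_add_mul (Int.emod_nonneg _ hN.ne')
    (Int.emod_lt_of_pos _ hN) h1
  rw [mem_latticePoints_interior_cone (ne_zero_of_isFaceVector hn), Fin.forall_fin_two, h, h,
    ← not_le, ← not_le, ← e1, ← e2, Int.ediv_nonneg_iff_of_pos hN, Int.ediv_nonneg_iff_of_pos hN]

theorem hasSum_subtype_of_injective {β γ : Type*} {g : γ → β} (hg : Function.Injective g)
    {A : Set β} (hA : Set.range g = A) {f : β → ℂ} {s : ℂ} (h : HasSum (fun x => f (g x)) s) :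
    HasSum (fun x : A => f x) s := by
  subst hA
  exact (Equiv.ofInjective g hg).hasSum_iff.mp h

theorem hasSum_fin_mul {N : ℕ} (u : Fin N → ℂ) {γ : Type*} {g : γ → ℂ} {s : ℂ} (h : HasSum g s) :
    HasSum (fun p : Fin N × γ => u p.1 * g p.2) ((∑ q, u q) * s) := by
  have hu : Summable fun q => ‖u q‖ := (hasSum_fintype _).summable
  have hs := summable_mul_of_summable_norm hu h.summable.norm
  have h2 := hasSum_fintype u
  exact h2.mul h hs

/-- Exponential sums over the lattice points of a planar cone. -/
theorem hasSum_exp_cone (hn : ∀ f, IsFaceVector v f (n f)) (ω : Fin 2 → ℂ) {t : ℂ}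
    (h : ∀ f, ‖Complex.exp (t * pair (ray v n f) ω)‖ < 1) :
    HasSum (fun p : latticePoints (cone v) => Complex.exp (t * pair p ω))
      ((∑ q : Fin (coneIndex v n).toNat, Complex.exp (t * pair (fundPoint v n (q : ℕ)) ω)) *
        ((1 - Complex.exp (t * pair (ray v n 1) ω))⁻¹ *
          (1 - Complex.exp (t * pair (ray v n 0) ω))⁻¹)) := by
  have hbij := latticeMap_bijective hn
  refine hasSum_subtype_of_injective (f := fun p => Complex.exp (t * pair p ω))
    (g := fun x : Fin (coneIndex v n).toNat × ℕ × ℕ =>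
      latticeMap v n ⟨x.1, x.2.1, x.2.2⟩) ?_ ?_ ?_
  · rintro ⟨q, k, l⟩ ⟨q', k', l'⟩ h
    simpa using hbij.1 h
  · ext p
    constructor
    · rintro ⟨x, rfl⟩
      rw [latticeMap_mem_cone hn]
      exact ⟨Int.natCast_nonneg _, Int.natCast_nonneg _⟩
    · intro hp
      obtain ⟨⟨q, k, l⟩, rfl⟩ := hbij.2 p
      obtain ⟨hk, hl⟩ := (latticeMap_mem_cone hn _).mp hp
      lift k to ℕ using hk
      lift l to ℕ using hl
      exact ⟨⟨q, k, l⟩, rfl⟩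
  · refine (hasSum_fin_mul _ (hasSum_mul_geometric (h 1) (h 0))).congr_fun fun x => ?_
    rw [← Complex.exp_nat_mul, ← Complex.exp_nat_mul, ← Complex.exp_add, ← Complex.exp_add,
      latticeMap, pair_add, pair_add, pair_zsmul, pair_zsmul]
    push_cast
    ring_nf

/-- Exponential sums over the interior lattice points of a planar cone. -/
theorem hasSum_exp_interior_cone (hn : ∀ f, IsFaceVector v f (n f)) (ω : Fin 2 → ℂ) {t : ℂ}
    (h : ∀ f, ‖Complex.exp (t * pair (ray v n f) ω)‖ < 1) :
    HasSum (fun p : latticePoints (interior (cone v)) => Complex.exp (t * pair p ω))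
      ((∑ q : Fin (coneIndex v n).toNat, Complex.exp (t * (pair (ray v n 1) ω +
        pair (ray v n 0) ω - pair (fundPoint v n (q : ℕ)) ω))) *
        ((1 - Complex.exp (t * pair (ray v n 1) ω))⁻¹ *
          (1 - Complex.exp (t * pair (ray v n 0) ω))⁻¹)) := by
  have hbij := latticeMap_bijective hn
  refine hasSum_subtype_of_injective (f := fun p => Complex.exp (t * pair p ω))
    (g := fun x : Fin (coneIndex v n).toNat × ℕ × ℕ =>
      -latticeMap v n ⟨x.1, -(x.2.1 + 1), -(x.2.2 + 1)⟩) ?_ ?_ ?_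
  · rintro ⟨q, k, l⟩ ⟨q', k', l'⟩ h
    simpa using hbij.1 (neg_injective h)
  · ext p
    constructor
    · rintro ⟨x, rfl⟩
      rw [neg_latticeMap_mem_interior_cone hn]
      simp only
      omega
    · intro hp
      obtain ⟨⟨q, k, l⟩, hx⟩ := hbij.2 (-p)
      rw [← neg_neg p, ← hx, neg_latticeMap_mem_interior_cone hn] at hp
      obtain ⟨hk, hl⟩ := hp
      simp only at hk hl
      refine ⟨⟨q, (-k - 1).toNat, (-l - 1).toNat⟩, ?_⟩
      simp only
      rw [show -(((-k - 1).toNat : ℤ) + 1) = k by omega,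
        show -(((-l - 1).toNat : ℤ) + 1) = l by omega, hx, neg_neg]
  · refine (hasSum_fin_mul _ (hasSum_mul_geometric (h 1) (h 0))).congr_fun fun x => ?_
    rw [← Complex.exp_nat_mul, ← Complex.exp_nat_mul, ← Complex.exp_add, ← Complex.exp_add,
      latticeMap, pair_neg, pair_add, pair_add, pair_zsmul, pair_zsmul]
    push_cast
    ring_nf

end LatticeSums

end ConeGamma

namespace ConeGamma

/-! ### Pairing with `ω`, and the distribution relation at a face -/

section Pairing

theorem eq_zero_of_im_div_ne_zero {ω : Fin 2 → ℂ} (hω : (ω 0 / ω 1).im ≠ 0) {x y : ℝ}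
    (h : x * ω 0 + y * ω 1 = 0) : x = 0 ∧ y = 0 := by
  have h1 : ω 1 ≠ 0 := by rintro h1; simp [h1] at hω
  have h2 : x * (ω 0 / ω 1) = ((-y : ℝ) : ℂ) := by
    field_simp
    push_cast
    linear_combination h
  have h3 := congrArg Complex.im h2
  rw [Complex.im_ofReal_mul, Complex.ofReal_im] at h3
  have hx : x = 0 := by simpa [hω] using h3
  refine ⟨hx, ?_⟩
  simpa [hx, h1] using h

theorem im_pair_div_pair_ne_zero {ω : Fin 2 → ℂ} (hω : (ω 0 / ω 1).im ≠ 0) {u w : Fin 2 → ℤ}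
    (h : u 0 * w 1 - u 1 * w 0 ≠ 0) : (pair u ω / pair w ω).im ≠ 0 := by
  intro him
  have hw : pair w ω ≠ 0 := by
    intro hw
    rw [pair, Fin.sum_univ_two] at hw
    obtain ⟨h0, h1⟩ := eq_zero_of_im_div_ne_zero hω (x := w 0) (y := w 1) (by exact_mod_cast hw)
    have h0 : w 0 = 0 := by exact_mod_cast h0
    have h1 : w 1 = 0 := by exact_mod_cast h1
    simp [h0, h1] at h
  set r := (pair u ω / pair w ω).re with hr
  have hur : pair u ω = r * pair w ω := by
    rw [← div_eq_iff hw]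
    exact Complex.ext rfl (by simpa using him)
  simp only [pair, Fin.sum_univ_two] at hur
  obtain ⟨h0, h1⟩ := eq_zero_of_im_div_ne_zero hω (x := u 0 - r * w 0) (y := u 1 - r * w 1) (by
    push_cast
    linear_combination hur)
  apply h
  have : ((u 0 * w 1 - u 1 * w 0 : ℤ) : ℝ) = 0 := by
    push_cast
    linear_combination (w 1 : ℝ) * h0 - (w 0 : ℝ) * h1
  exact_mod_cast this

variable {v n : Fin 2 → Fin 2 → ℤ}

theorem im_corayVec_div_ray_ne_zero (hn : ∀ f, IsFaceVector v f (n f)) {ω : Fin 2 → ℂ}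
    (hω : (ω 0 / ω 1).im ≠ 0) (f : Fin 2) :
    (pair (corayVec v n f) ω / pair (ray v n f) ω).im ≠ 0 := by
  refine im_pair_div_pair_ne_zero hω ?_
  have h : ((columns (n f) (v f))⁻¹).det ≠ 0 := by
    intro h
    have h2 := congrArg Matrix.det (Matrix.nonsing_inv_mul _ (isUnit_det_columns hn f))
    rw [Matrix.det_mul, h, zero_mul, Matrix.det_one] at h2
    exact zero_ne_one h2
  rw [Matrix.det_fin_two] at h
  intro h2
  apply h
  simp only [ray, corayVec] at h2
  linarith

theorem pair_ray_other (hn : ∀ f, IsFaceVector v f (n f)) (ω : Fin 2 → ℂ) (f : Fin 2) :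
    pair (ray v n (1 - f)) ω =
      coneIndex v n * pair (corayVec v n f) ω - corayShift v n f * pair (ray v n f) ω := by
  rw [ray_other hn f, sub_eq_add_neg, ← neg_smul, pair_add, pair_zsmul, pair_zsmul]
  push_cast
  ring

theorem coneIndex_smul (hn : ∀ f, IsFaceVector v f (n f)) (p : Fin 2 → ℤ) :
    coneIndex v n • p = (p ⬝ᵥ v 1) • ray v n 0 + (p ⬝ᵥ v 0) • ray v n 1 := by
  have h1 := (ray_dotProduct hn 0).2.1
  have h2 := (ray_dotProduct hn 1).2.1
  have h3 := ray_dotProduct_other hn 0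
  have h4 := ray_dotProduct_other hn 1
  rw [sub_zero] at h3
  rw [sub_self] at h4
  apply eq_of_dotProduct_eq hn
  rw [Fin.forall_fin_two]
  constructor <;> simp only [add_dotProduct, smul_dotProduct, h1, h2, h3, h4, smul_eq_mul] <;> ring

theorem coneIndex_mul_pair (hn : ∀ f, IsFaceVector v f (n f)) (ω : Fin 2 → ℂ) (p : Fin 2 → ℤ) :
    coneIndex v n * pair p ω =
      ((p ⬝ᵥ v 1 : ℤ) : ℂ) * pair (ray v n 0) ω + ((p ⬝ᵥ v 0 : ℤ) : ℂ) * pair (ray v n 1) ω := by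
  rw [← pair_zsmul, ← pair_zsmul, ← pair_zsmul, ← pair_add, coneIndex_smul hn]

theorem im_pair_of_coneIndex (hn : ∀ f, IsFaceVector v f (n f)) (ω : Fin 2 → ℂ) (p : Fin 2 → ℤ) :
    coneIndex v n * (pair p ω).im =
      (p ⬝ᵥ v 1 : ℤ) * (pair (ray v n 0) ω).im + (p ⬝ᵥ v 0 : ℤ) * (pair (ray v n 1) ω).im := by
  have h := congrArg Complex.im (coneIndex_mul_pair hn ω p)
  simp only [Complex.add_im, ← Complex.ofReal_intCast, Complex.im_ofReal_mul] at h
  exact h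

/-- For the first face this is the indexing itself. For the second, `q ↦ q * corayShift v n 0`
permutes the residues mod the index, as the shift is invertible there. -/
theorem sum_fundPoint_dotProduct (hn : ∀ f, IsFaceVector v f (n f)) (f : Fin 2) (g : ℤ → ℂ) :
    ∑ q : Fin (coneIndex v n).toNat, g (fundPoint v n (q : ℕ) ⬝ᵥ v f) =
      ∑ q : Fin (coneIndex v n).toNat, g (q : ℕ) := by
  have hN := coneIndex_pos hn
  fin_cases f
  · exact Finset.sum_congr rfl fun q _ => congrArg g (fundPoint_dotProduct_zero hn _)
  · have hlt : ∀ q : Fin (coneIndex v n).toNat,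
        ((q : ℕ) * corayShift v n 0 % coneIndex v n).toNat < (coneIndex v n).toNat := fun q => by
      have := Int.emod_lt_of_pos ((q : ℕ) * corayShift v n 0) hN
      omega
    let r : Fin (coneIndex v n).toNat → Fin (coneIndex v n).toNat := fun q => ⟨_, hlt q⟩
    have hr : ∀ q, ((r q : ℕ) : ℤ) = (q : ℕ) * corayShift v n 0 % coneIndex v n := fun q =>
      Int.toNat_of_nonneg (Int.emod_nonneg _ hN.ne')
    have hinj : Function.Injective r := by
      intro q q' h
      have h1 : (q : ℕ) * corayShift v n 0 % coneIndex v n =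
          (q' : ℕ) * corayShift v n 0 % coneIndex v n := by rw [← hr, ← hr, h]
      have h2 : coneIndex v n ∣ ((q : ℕ) - (q' : ℕ) : ℤ) * corayShift v n 0 := by
        rw [sub_mul]; exact (Int.ModEq.dvd (Int.ModEq.symm h1))
      have h3 : coneIndex v n ∣ ((q : ℕ) - (q' : ℕ) : ℤ) := by
        obtain ⟨i, hi⟩ := h2
        obtain ⟨j, hj⟩ := corayShift_mul_modEq hn
        exact ⟨i * corayShift v n 1 - ((q : ℕ) - (q' : ℕ) : ℤ) * j, by
          linear_combination corayShift v n 1 * hi - ((q : ℕ) - (q' : ℕ) : ℤ) * hj⟩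
      have hq := q.2
      have hq' := q'.2
      have h5 := Int.eq_zero_of_abs_lt_dvd h3 (by rw [abs_lt]; omega)
      exact Fin.ext (by omega)
    have hbij : Function.Bijective r := Finite.injective_iff_bijective.mp hinj
    rw [← hbij.sum_comp (fun q => g (q : ℕ))]
    refine Finset.sum_congr rfl fun q _ => ?_
    rw [hr]
    exact congrArg g (fundPoint_dotProduct_one _)

end Pairing

section Distribution

theorem e_intCast_mul_add_intCast (k m : ℤ) (w : ℂ) : e (k * (w + m)) = e (k * w) := by
  rw [mul_add, e_add, ← Int.cast_mul, e_intCast, mul_one]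

variable {v n : Fin 2 → Fin 2 → ℤ}

/-- The distribution relation expressing the series of a face through the fundamental points. -/
theorem sum_gammaTerm_fundPoint (hn : ∀ f, IsFaceVector v f (n f)) {ω : Fin 2 → ℂ}
    (hω : (ω 0 / ω 1).im ≠ 0) (f : Fin 2) (ha : pair (ray v n f) ω ≠ 0) (z τ : ℂ) (k : ℤ) :
    ∑ q : Fin (coneIndex v n).toNat,
      gammaTerm ((z + pair (fundPoint v n (q : ℕ)) ω) / pair (ray v n f) ω) τ
        (pair (ray v n (1 - f)) ω / pair (ray v n f) ω) k =
      gammaTerm (z / pair (ray v n f) ω) τ (pair (corayVec v n f) ω / pair (ray v n f) ω) k := by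
  rcases eq_or_ne k 0 with rfl | hk
  · simp [gammaTerm]
  have hN := coneIndex_pos hn
  have him := im_corayVec_div_ray_ne_zero hn hω f
  have hc := pair_ray_other hn ω f
  set a := pair (ray v n f) ω with hadef
  set b := pair (corayVec v n f) ω with hb
  set y := e (k * (b / a)) with hy
  -- Modulo integers, which `e (k * ·)` does not see, the other ray is the index times `b / a`.
  have hca : pair (ray v n (1 - f)) ω / a =
      ((coneIndex v n).toNat : ℂ) * (b / a) + (-corayShift v n f : ℤ) := by
    have : ((coneIndex v n).toNat : ℂ) = (coneIndex v n : ℂ) := by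
      exact_mod_cast congrArg (Int.cast : ℤ → ℂ) (Int.toNat_of_nonneg hN.le)
    rw [hc, this]
    field_simp
    push_cast
    ring
  have hyc : e (k * (pair (ray v n (1 - f)) ω / a)) = y ^ (coneIndex v n).toNat := by
    rw [hca, e_intCast_mul_add_intCast, hy, ← e_natCast_mul]
    ring_nf
  have hy1 : y ≠ 1 := e_intCast_mul_ne_one him hk
  have hP : ∀ q : Fin (coneIndex v n).toNat,
      e (k * ((z + pair (fundPoint v n (q : ℕ)) ω) / a)) =
        e (k * (z / a)) * y ^ (fundPoint v n (q : ℕ) ⬝ᵥ v f) := by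
    intro q
    have h1 : pair (fundPoint v n (q : ℕ)) ω =
        ((fundPoint v n (q : ℕ) ⬝ᵥ n f : ℤ) : ℂ) * a +
          ((fundPoint v n (q : ℕ) ⬝ᵥ v f : ℤ) : ℂ) * b := by
      conv_lhs => rw [eq_ray_add_corayVec hn f (fundPoint v n (q : ℕ)), pair_add, pair_zsmul,
        pair_zsmul]
    have h2 : (z + pair (fundPoint v n (q : ℕ)) ω) / a =
        (z / a + ((fundPoint v n (q : ℕ) ⬝ᵥ v f : ℤ) : ℂ) * (b / a)) +
          ((fundPoint v n (q : ℕ) ⬝ᵥ n f : ℤ) : ℂ) := by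
      rw [h1]; field_simp; ring
    rw [h2, e_intCast_mul_add_intCast, mul_add, e_add]
    congr 1
    rw [hy, e, e, ← Complex.exp_int_mul]
    ring_nf
  -- This geometric sum trades the denominator `y ^ N - 1` of the other ray, `N` the index, for the
  -- denominator `y - 1` of `corayVec`.
  have hsum : ∑ q : Fin (coneIndex v n).toNat, y ^ (fundPoint v n (q : ℕ) ⬝ᵥ v f) =
      (y ^ (coneIndex v n).toNat - 1) * (y - 1)⁻¹ := by
    rw [sum_fundPoint_dotProduct hn f (fun j => y ^ j)]
    simp only [zpow_natCast]
    rw [Fin.sum_univ_eq_sum_range (fun j => y ^ j), ← div_eq_mul_inv, geom_sum_eq hy1]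
  have hne : y ^ (coneIndex v n).toNat - 1 ≠ 0 := by
    rw [← hyc, sub_ne_zero]
    refine e_intCast_mul_ne_one ?_ hk
    rw [hca, Complex.add_im, ← Complex.ofReal_natCast, Complex.im_ofReal_mul]
    simp only [Complex.intCast_im, add_zero]
    refine mul_ne_zero ?_ him
    have : 0 < (coneIndex v n).toNat := by omega
    exact_mod_cast this.ne'
  simp only [gammaTerm, hyc, hP, ← hy]
  calc _ = (k : ℂ)⁻¹ * e (k * (z / a)) * (e (k * τ) - 1)⁻¹ * (y ^ (coneIndex v n).toNat - 1)⁻¹ *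
        ∑ q : Fin (coneIndex v n).toNat, y ^ (fundPoint v n (q : ℕ) ⬝ᵥ v f) := by
        rw [Finset.mul_sum]
        exact Finset.sum_congr rfl fun q _ => by ring
    _ = _ := by
        rw [hsum]
        field_simp

theorem homogeneous_S_mul_K (ω : Fin 2 → ℂ) (f : Fin 2) :
    homogeneous (S * K (n f) (v f)) ω =
      ![-1, pair (corayVec v n f) ω, pair (ray v n f) ω] := by
  ext i
  simp only [homogeneous, S, K, Matrix.mulVec, dotProduct, Fin.sum_univ_three, Matrix.map_apply,
    Matrix.mul_apply, pair, Fin.sum_univ_two, ray, corayVec]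
  fin_cases i <;> simp

theorem pullbackG_S_mul_K (z : ℂ) (ω : Fin 2 → ℂ) (f : Fin 2) :
    pullbackG (S * K (n f) (v f)) z ω =
      G 1 (z / pair (ray v n f) ω)
        ![-1 / pair (ray v n f) ω, pair (corayVec v n f) ω / pair (ray v n f) ω] := by
  simp [pullbackG, homogeneous_S_mul_K]

end Distribution

/-! ### The gamma function of a planar cone -/

section ConeProduct

variable {v n : Fin 2 → Fin 2 → ℤ}

theorem norm_e_lt_one {z : ℂ} (hz : 0 < z.im) : ‖e z‖ < 1 := by
  rw [norm_e, Real.exp_lt_one_iff, neg_lt_zero]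
  have := Real.pi_pos
  positivity

theorem hasSum_e_pow_cone (hn : ∀ f, IsFaceVector v f (n f)) {ω : Fin 2 → ℂ}
    (hω : ∀ f, 0 < (pair (ray v n f) ω).im) {k : ℕ} (hk : k ≠ 0) :
    HasSum (fun p : latticePoints (cone v) => e (pair p ω) ^ k)
      (∑ q : Fin (coneIndex v n).toNat, e (pair (fundPoint v n (q : ℕ)) ω) ^ k *
        ((1 - e (pair (ray v n 0) ω) ^ k)⁻¹ * (1 - e (pair (ray v n 1) ω) ^ k)⁻¹)) := by
  have he : ∀ w, e w ^ k = Complex.exp (2 * Real.pi * Complex.I * k * w) := fun w => by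
    rw [← e_natCast_mul, e, ← mul_assoc]
  have h := hasSum_exp_cone hn ω (t := 2 * Real.pi * Complex.I * k) fun f => by
    rw [← he, norm_pow]; exact pow_lt_one₀ (norm_nonneg _) (norm_e_lt_one (hω f)) hk
  simp only [← he] at h
  rwa [mul_comm (1 - _)⁻¹, Finset.sum_mul] at h

theorem hasSum_e_pow_interior_cone (hn : ∀ f, IsFaceVector v f (n f)) {ω : Fin 2 → ℂ}
    (hω : ∀ f, 0 < (pair (ray v n f) ω).im) {k : ℕ} (hk : k ≠ 0) :
    HasSum (fun p : latticePoints (interior (cone v)) => e (pair p ω) ^ k)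
      (∑ q : Fin (coneIndex v n).toNat, e (pair (ray v n 0) ω + pair (ray v n 1) ω -
          pair (fundPoint v n (q : ℕ)) ω) ^ k *
        ((1 - e (pair (ray v n 0) ω) ^ k)⁻¹ * (1 - e (pair (ray v n 1) ω) ^ k)⁻¹)) := by
  have he : ∀ w, e w ^ k = Complex.exp (2 * Real.pi * Complex.I * k * w) := fun w => by
    rw [← e_natCast_mul, e, ← mul_assoc]
  have h := hasSum_exp_interior_cone hn ω (t := 2 * Real.pi * Complex.I * k) fun f => by
    rw [← he, norm_pow]; exact pow_lt_one₀ (norm_nonneg _) (norm_e_lt_one (hω f)) hk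
  simp only [← he] at h
  rwa [mul_comm (1 - _)⁻¹, Finset.sum_mul, add_comm (pair (ray v n 1) ω)] at h

theorem summable_e_cone (hn : ∀ f, IsFaceVector v f (n f)) {ω : Fin 2 → ℂ}
    (hω : ∀ f, 0 < (pair (ray v n f) ω).im) :
    Summable fun p : latticePoints (cone v) => e (pair p ω) := by
  simpa using (hasSum_e_pow_cone hn hω one_ne_zero).summable

theorem summable_e_interior_cone (hn : ∀ f, IsFaceVector v f (n f)) {ω : Fin 2 → ℂ}
    (hω : ∀ f, 0 < (pair (ray v n f) ω).im) :
    Summable fun p : latticePoints (interior (cone v)) => e (pair p ω) := by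
  simpa using (hasSum_e_pow_interior_cone hn hω one_ne_zero).summable

theorem coneG_one_eq (z : ℂ) (ω : Fin 2 → ℂ) : coneG 1 v z ω =
    (∏' p : latticePoints (cone v), (1 - e z * e (pair p ω)))⁻¹ *
      ∏' p : latticePoints (interior (cone v)), (1 - (e z)⁻¹ * e (pair p ω)) := by
  simp only [coneG, pow_one, zpow_neg_one, e_add, e_neg]

theorem meromorphic_coneG_one (hn : ∀ f, IsFaceVector v f (n f)) {ω : Fin 2 → ℂ}
    (hω : ∀ f, 0 < (pair (ray v n f) ω).im) : Meromorphic fun z => coneG 1 v z ω := by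
  have he : Differentiable ℂ e := by unfold e; fun_prop
  have h1 : Differentiable ℂ fun z => ∏' p : latticePoints (cone v), (1 - e z * e (pair p ω)) :=
    (differentiable_tprod_one_sub_mul (summable_e_cone hn hω)).comp he
  have h2 : Differentiable ℂ fun z =>
      ∏' p : latticePoints (interior (cone v)), (1 - (e z)⁻¹ * e (pair p ω)) :=
    (differentiable_tprod_one_sub_mul (summable_e_interior_cone hn hω)).comp
      (he.inv e_ne_zero)
  simp only [coneG_one_eq]
  exact fun z => (h1.analyticAt z).meromorphicAt.inv.mul (h2.analyticAt z).meromorphicAt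

/-- The series for the logarithm of the gamma function of a planar cone. -/
theorem coneG_one_eq_exp (hn : ∀ f, IsFaceVector v f (n f)) {ω : Fin 2 → ℂ}
    (hω : ∀ f, 0 < (pair (ray v n f) ω).im) {z : ℂ} (hz : 0 < z.im)
    (hz' : coneIndex v n * z.im < (pair (ray v n 0) ω).im + (pair (ray v n 1) ω).im) :
    ∃ T, HasSum (fun k => ∑ q : Fin (coneIndex v n).toNat,
        gammaTerm (z + pair (fundPoint v n (q : ℕ)) ω) (pair (ray v n 0) ω)
          (pair (ray v n 1) ω) k) T ∧ coneG 1 v z ω = Complex.exp T := by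
  have hN : (0 : ℝ) < coneIndex v n := by exact_mod_cast coneIndex_pos hn
  have ha := hω 0
  have hc := hω 1
  obtain ⟨A, hA, hA'⟩ := exists_hasSum_powerSum_tprod_eq (summable_e_cone hn hω) (x := e z)
    (fun p => by
      rw [← e_add]
      refine norm_e_lt_one ?_
      have h := im_pair_of_coneIndex hn ω p
      have hp := mem_latticePoints_cone.mp p.2
      have h0 : (0 : ℝ) ≤ ((p : Fin 2 → ℤ) ⬝ᵥ v 0 : ℤ) := by exact_mod_cast hp 0
      have h1 : (0 : ℝ) ≤ ((p : Fin 2 → ℤ) ⬝ᵥ v 1 : ℤ) := by exact_mod_cast hp 1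
      have : 0 ≤ (pair p ω).im := by
        refine nonneg_of_mul_nonneg_right ?_ hN
        rw [h]
        positivity
      rw [Complex.add_im]
      linarith) (fun k hk => hasSum_e_pow_cone hn hω hk)
  obtain ⟨B, hB, hB'⟩ := exists_hasSum_powerSum_tprod_eq (summable_e_interior_cone hn hω)
    (x := (e z)⁻¹) (fun p => by
      rw [← e_neg, ← e_add]
      refine norm_e_lt_one ?_
      have h := im_pair_of_coneIndex hn ω p
      have hp := (mem_latticePoints_interior_cone (ne_zero_of_isFaceVector hn)).mp p.2
      have h0 : (1 : ℝ) ≤ ((p : Fin 2 → ℤ) ⬝ᵥ v 0 : ℤ) := by exact_mod_cast hp 0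
      have h1 : (1 : ℝ) ≤ ((p : Fin 2 → ℤ) ⬝ᵥ v 1 : ℤ) := by exact_mod_cast hp 1
      -- Both products with the normals are integers at least `1`, so the index times `(pair p
      -- ω).im` is at least the sum of the imaginary parts of the two rays, which exceeds the index
      -- times `z.im`.
      have : z.im < (pair p ω).im := by
        refine lt_of_mul_lt_mul_left ?_ hN.le
        rw [h]
        nlinarith
      rw [Complex.add_im, Complex.neg_im]
      linarith) (fun k hk => hasSum_e_pow_interior_cone hn hω hk)
  refine ⟨A - B, ?_, ?_⟩
  · set g : ℤ → ℂ := fun k => ∑ q : Fin (coneIndex v n).toNat,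
        gammaTerm (z + pair (fundPoint v n (q : ℕ)) ω) (pair (ray v n 0) ω)
          (pair (ray v n 1) ω) k with hg
    have h1 : HasSum (fun k : ℕ => g k) A := by
      refine hA.congr_fun fun k => ?_
      simp only [hg, gammaTerm_natCast, e_add, mul_pow, Finset.mul_sum]
      exact Finset.sum_congr rfl fun q _ => by ring
    have h2 : HasSum (fun k : ℕ => g (-k)) (-B) := by
      refine hB.neg.congr_fun fun k => ?_
      simp only [hg, gammaTerm_neg_natCast, Finset.mul_sum, Finset.sum_neg_distrib]
      congr 1
      refine Finset.sum_congr rfl fun q _ => ?_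
      rw [show pair (ray v n 0) ω + pair (ray v n 1) ω - (z + pair (fundPoint v n (q : ℕ)) ω) =
        -z + (pair (ray v n 0) ω + pair (ray v n 1) ω - pair (fundPoint v n (q : ℕ)) ω) by ring,
        e_add, e_neg, mul_pow]
      ring
    have := HasSum.of_nat_of_neg h1 h2
    rwa [show g 0 = 0 by simp [hg, gammaTerm], sub_zero, ← sub_eq_add_neg] at this
  · rw [coneG_one_eq, hA', hB', ← Complex.exp_neg, neg_neg, ← Complex.exp_add, sub_eq_add_neg]

end ConeProduct

end ConeGamma

/-! ### Bernoulli polynomials of the three-dimensional cone -/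

/-- A power series that sums to zero frequently near the origin vanishes. -/
theorem eq_zero_of_frequently_hasSum_zero {d : ℕ → ℂ}
    (h : ∃ᶠ t in 𝓝[≠] (0 : ℂ), HasSum (fun k => d k * t ^ k) 0) : d = 0 := by
  set p := FormalMultilinearSeries.ofScalars ℂ d with hp
  have happ : ∀ (t : ℂ) k, p k (fun _ => t) = d k * t ^ k := fun t k => by
    simp [hp, mul_comm]
  obtain ⟨t, ht, ht0⟩ := (h.and_eventually self_mem_nhdsWithin).exists
  have ht0 : t ≠ 0 := ht0
  have hrad : 0 < p.radius := by
    have h1 : (‖t‖₊ : ENNReal) ≤ p.radius := by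
      refine p.le_radius_of_tendsto (l := 0) ?_
      have h2 := ht.summable.tendsto_atTop_zero.norm
      simpa [hp, FormalMultilinearSeries.ofScalars_norm] using h2
    exact lt_of_lt_of_le (by simpa using ht0) h1
  have hps := (p.hasFPowerSeriesOnBall hrad).hasFPowerSeriesAt
  have hfreq : ∃ᶠ t in 𝓝[≠] (0 : ℂ), p.sum t = 0 := h.mono fun t ht => by
    simp only [FormalMultilinearSeries.sum, happ, ht.tsum_eq]
  have hev := (hps.analyticAt.frequently_zero_iff_eventually_zero).mp hfreq
  have hp0 : p = 0 := HasFPowerSeriesAt.eq_zero (hps.congr hev)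
  rwa [hp, FormalMultilinearSeries.ofScalars_series_eq_zero] at hp0

namespace ConeGamma

variable {v n : Fin 2 → Fin 2 → ℤ}

theorem tildeNormals_ne_zero (hn : ∀ f, IsFaceVector v f (n f)) (i : Fin 3) :
    tildeNormals v i ≠ 0 := by
  have hv := ne_zero_of_isFaceVector hn
  intro h
  fin_cases i
  · refine hv 0 (funext fun j => ?_)
    have h0 := congrFun h 0
    have h1 := congrFun h 1
    fin_cases j
    · exact h0
    · exact h1
  · refine hv 1 (funext fun j => ?_)
    have h0 := congrFun h 0
    have h1 := congrFun h 1
    fin_cases j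
    · exact h0
    · exact h1
  · exact one_ne_zero (congrFun h 2)

theorem mem_latticePoints_interior_tildeCone (hn : ∀ f, IsFaceVector v f (n f))
    {p : Fin 2 → ℤ} {k : ℤ} :
    ![p 0, p 1, k] ∈ latticePoints (interior (cone (tildeNormals v))) ↔
      p ∈ latticePoints (interior (cone v)) ∧ 0 < k := by
  rw [mem_latticePoints_interior_cone (tildeNormals_ne_zero hn),
    mem_latticePoints_interior_cone (ne_zero_of_isFaceVector hn), Fin.forall_fin_two]
  simp [Fin.forall_fin_succ, dotProduct, Fin.sum_univ_succ, tildeNormals, and_assoc]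

theorem pair_tilde (p : Fin 2 → ℤ) (k : ℤ) (ω : Fin 2 → ℂ) :
    pair ![p 0, p 1, k] ![ω 0, ω 1, -1] = pair p ω - k := by
  simp [pair, Fin.sum_univ_succ]
  ring

/-- Exponential sums over the interior lattice points of `C × ℝ_{≥ 0}`. -/
theorem hasSum_exp_interior_tildeCone (hn : ∀ f, IsFaceVector v f (n f)) (ω : Fin 2 → ℂ) {t : ℂ}
    (h : ∀ f, ‖Complex.exp (-t * pair (ray v n f) ω)‖ < 1) (ht : ‖Complex.exp t‖ < 1) :
    HasSum (fun p : latticePoints (interior (cone (tildeNormals v))) =>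
        Complex.exp (-(pair p ![ω 0, ω 1, -1]) * t))
      (((∑ q : Fin (coneIndex v n).toNat, Complex.exp (-t * (pair (ray v n 1) ω +
        pair (ray v n 0) ω - pair (fundPoint v n (q : ℕ)) ω))) *
        ((1 - Complex.exp (-t * pair (ray v n 1) ω))⁻¹ *
          (1 - Complex.exp (-t * pair (ray v n 0) ω))⁻¹)) *
        (Complex.exp t * (1 - Complex.exp t)⁻¹)) := by
  refine hasSum_subtype_of_injective
    (f := fun p => Complex.exp (-(pair p ![ω 0, ω 1, -1]) * t))
    (g := fun x : latticePoints (interior (cone v)) × ℕ =>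
      ![(x.1 : Fin 2 → ℤ) 0, (x.1 : Fin 2 → ℤ) 1, (x.2 : ℤ) + 1]) ?_ ?_ ?_
  · rintro ⟨⟨p, hp⟩, k⟩ ⟨⟨p', hp'⟩, k'⟩ h
    have h0 := congrFun h 0
    have h1 := congrFun h 1
    have h2 := congrFun h 2
    simp only [Matrix.cons_val] at h0 h1 h2
    have hpp : p = p' := funext fun j => by fin_cases j <;> assumption
    have hkk : k = k' := by omega
    subst hpp hkk
    rfl
  · ext p
    have hp : p = ![p 0, p 1, p 2] := by ext j; fin_cases j <;> rfl
    have key := mem_latticePoints_interior_tildeCone hn (p := ![p 0, p 1]) (k := p 2)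
    simp only [Matrix.cons_val_zero, Matrix.cons_val_one] at key
    rw [← hp] at key
    constructor
    · rintro ⟨⟨x, k⟩, rfl⟩
      exact (mem_latticePoints_interior_tildeCone hn).mpr ⟨x.2, by positivity⟩
    · intro h
      obtain ⟨h1, h2⟩ := key.mp h
      refine ⟨⟨⟨_, h1⟩, (p 2 - 1).toNat⟩, ?_⟩
      have : (((p 2 - 1).toNat : ℤ) + 1) = p 2 := by omega
      simp only [this]
      exact hp.symm
  · have h1 := hasSum_exp_interior_cone hn ω h
    have h2 := (hasSum_geometric_of_norm_lt_one ht).mul_left (Complex.exp t)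
    have h3 := summable_mul_of_summable_norm h1.summable.norm h2.summable.norm
    refine (h1.mul h2 h3).congr_fun fun x => ?_
    rw [pair_tilde, ← Complex.exp_nat_mul, ← Complex.exp_add, ← Complex.exp_add]
    congr 1
    push_cast
    ring

/-- Along a ray, or along the third axis, the series restricts to a geometric one. So absolute
convergence at `t` already places `t` where the closed form of the sum is valid. -/
theorem norm_exp_lt_one_of_summable (hn : ∀ f, IsFaceVector v f (n f)) {ω : Fin 2 → ℂ} {t : ℂ}
    (h : Summable fun p : latticePoints (interior (cone (tildeNormals v))) =>
        Complex.exp (-(pair p ![ω 0, ω 1, -1]) * t)) :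
    (∀ f, ‖Complex.exp (-t * pair (ray v n f) ω)‖ < 1) ∧ ‖Complex.exp t‖ < 1 := by
  have hgeom : ∀ A r : ℂ, A ≠ 0 → (Summable fun k : ℕ => A * r ^ k) → ‖r‖ < 1 := by
    intro A r hA hs
    have := hs.mul_left A⁻¹
    simp only [inv_mul_cancel_left₀ hA] at this
    exact summable_geometric_iff_norm_lt_one.mp this
  have hN := coneIndex_pos hn
  have hray : ∀ f i, 0 ≤ ray v n f ⬝ᵥ v i := by
    intro f i
    have : i = f ∨ i = 1 - f := by fin_cases i <;> fin_cases f <;> simp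
    rcases this with rfl | rfl
    · exact (ray_dotProduct hn _).2.1.ge
    · rw [ray_dotProduct_other hn]; exact hN.le
  have hsum : ∀ i, 0 < (ray v n 0 + ray v n 1) ⬝ᵥ v i := by
    intro i
    rw [add_dotProduct]
    have h0 := hray 0 i
    have h1 := hray 1 i
    have h3 := ray_dotProduct_other hn 0
    have h4 := ray_dotProduct_other hn 1
    rw [sub_zero] at h3
    rw [sub_self] at h4
    fin_cases i
    · simp only [Fin.zero_eta] at *; omega
    · simp only [Fin.mk_one] at *; omega
  have hmem : ∀ (f : Fin 2) (k l : ℕ), ![(ray v n 0 + ray v n 1 + (k : ℤ) • ray v n f) 0,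
      (ray v n 0 + ray v n 1 + (k : ℤ) • ray v n f) 1, (l : ℤ) + 1] ∈
      latticePoints (interior (cone (tildeNormals v))) := by
    intro f k l
    rw [mem_latticePoints_interior_tildeCone hn,
      mem_latticePoints_interior_cone (ne_zero_of_isFaceVector hn)]
    refine ⟨fun i => ?_, by positivity⟩
    rw [add_dotProduct, smul_dotProduct, smul_eq_mul]
    have h1 := hsum i
    have h2 : 0 ≤ (k : ℤ) * (ray v n f ⬝ᵥ v i) := mul_nonneg (by positivity) (hray f i)
    omega
  constructor
  · intro f
    have hinj : Function.Injective fun k : ℕ =>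
        (⟨_, hmem f k 0⟩ : latticePoints (interior (cone (tildeNormals v)))) := by
      intro k k' hk
      simp only [Subtype.mk.injEq] at hk
      have h0 := congrFun hk 0
      have h1 := congrFun hk 1
      simp only [Matrix.cons_val, Pi.add_apply, Pi.smul_apply, smul_eq_mul, add_right_inj,
        mul_eq_mul_right_iff, Nat.cast_inj] at h0 h1
      rcases h0 with h0 | h0
      · exact h0
      rcases h1 with h1 | h1
      · exact h1
      exact absurd (funext fun j => by fin_cases j <;> assumption) (ray_ne_zero hn f)
    refine hgeom (Complex.exp (-(pair (ray v n 0 + ray v n 1) ω - 1) * t)) _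
      (Complex.exp_ne_zero _) ((h.comp_injective hinj).congr fun k => ?_)
    simp only [Function.comp]
    rw [pair_tilde, pair_add, pair_zsmul, ← Complex.exp_nat_mul, ← Complex.exp_add]
    congr 1
    push_cast
    ring
  · have hinj : Function.Injective fun k : ℕ =>
        (⟨_, hmem 0 0 k⟩ : latticePoints (interior (cone (tildeNormals v)))) := by
      intro k k' hk
      have := congrFun (Subtype.ext_iff.mp hk) 2
      simpa using this
    refine hgeom (Complex.exp (-(pair (ray v n 0 + ray v n 1) ω - 1) * t)) _
      (Complex.exp_ne_zero _) ((h.comp_injective hinj).congr fun k => ?_)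
    simp only [Function.comp]
    rw [pair_tilde, pair_add, pair_zsmul, ← Complex.exp_nat_mul, ← Complex.exp_add]
    congr 1
    push_cast
    ring

/-- The generating function of the Bernoulli polynomials of `C × ℝ_{≥ 0}` is a sum of those of
simplicial unimodular cones. -/
theorem generating_eq_sum_tripleGenerating {a c : ℂ} (ha : a ≠ 0) (hc : c ≠ 0) {N : ℕ}
    (P : Fin N → ℂ) (z : ℂ) {t : ℂ} (ht : t ≠ 0) :
    t ^ 3 * Complex.exp (z * t) * (((∑ q, Complex.exp (-t * (c + a - P q))) *
        ((1 - Complex.exp (-t * c))⁻¹ * (1 - Complex.exp (-t * a))⁻¹)) *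
        (Complex.exp t * (1 - Complex.exp t)⁻¹)) =
      ∑ q, tripleGenerating ![a, c, -1] (z + P q) t := by
  have hα : ∀ i, ![a, c, -1] i ≠ 0 := by
    intro i; fin_cases i <;> simp [ha, hc]
  have key : ∀ w : ℂ, Complex.exp (-w) * (1 - Complex.exp (-w))⁻¹ = (Complex.exp w - 1)⁻¹ := by
    intro w
    rw [show Complex.exp w - 1 = Complex.exp w * (1 - Complex.exp (-w)) by
      rw [mul_sub, ← Complex.exp_add]; simp, mul_inv, Complex.exp_neg]
  have hk1 := key (a * t)
  have hk2 := key (c * t)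
  have hk3 := key (-1 * t)
  rw [show -(-1 * t) = t by ring] at hk3
  simp only [tripleGenerating_eq hα _ ht, Fin.prod_univ_three, Matrix.cons_val]
  rw [← hk1, ← hk2, ← hk3, Finset.sum_mul, Finset.sum_mul, Finset.mul_sum]
  refine Finset.sum_congr rfl fun q _ => ?_
  rw [show -t * (c + a - P q) = P q * t + (-(a * t) + -(c * t)) by ring, Complex.exp_add,
    Complex.exp_add, add_mul z, Complex.exp_add, show -t * c = -(c * t) by ring,
    show -t * a = -(a * t) by ring]
  ring

/-- The values of the Bernoulli polynomials of `C × ℝ_{≥ 0}`. -/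
noncomputable def tildeBernoulli (v n : Fin 2 → Fin 2 → ℤ) (ω : Fin 2 → ℂ) (z : ℂ) (k : ℕ) : ℂ :=
  ∑ q : Fin (coneIndex v n).toNat, iteratedDeriv k (tripleGenerating
    ![pair (ray v n 0) ω, pair (ray v n 1) ω, -1] (z + pair (fundPoint v n (q : ℕ)) ω)) 0

theorem eventually_hasSum_tripleGenerating {α : Fin 3 → ℂ} (hα : ∀ i, α i ≠ 0) (z : ℂ) :
    ∀ᶠ t in 𝓝 (0 : ℂ), HasSum
      (fun k : ℕ => iteratedDeriv k (tripleGenerating α z) 0 * t ^ k / (k ! : ℂ))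
      (tripleGenerating α z t) := by
  filter_upwards [(analyticAt_tripleGenerating hα z).hasFPowerSeriesAt.eventually_hasSum] with t ht
  rw [zero_add] at ht
  refine ht.congr_fun fun k => ?_
  simp
  ring

variable {ω : Fin 2 → ℂ}

theorem eventually_hasSum_tildeBernoulli (hn : ∀ f, IsFaceVector v f (n f))
    (hω : ∀ f, 0 < (pair (ray v n f) ω).im) (z : ℂ) : ∀ᶠ t in 𝓝 (0 : ℂ),
    Summable (fun p : latticePoints (interior (cone (tildeNormals v))) =>
        Complex.exp (-(pair p ![ω 0, ω 1, -1]) * t)) →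
    HasSum (fun k : ℕ => tildeBernoulli v n ω z k * t ^ k / (k ! : ℂ))
      (t ^ 3 * Complex.exp (z * t) *
        ∑' p : latticePoints (interior (cone (tildeNormals v))),
          Complex.exp (-(pair p ![ω 0, ω 1, -1]) * t)) := by
  have h0 : ∀ f, pair (ray v n f) ω ≠ 0 := fun f h => by
    have := hω f
    simp [h] at this
  have hα : ∀ i, ![pair (ray v n 0) ω, pair (ray v n 1) ω, -1] i ≠ 0 := by
    intro i; fin_cases i <;> simp [h0]
  have hev := eventually_all.mpr fun q : Fin (coneIndex v n).toNat =>
    eventually_hasSum_tripleGenerating hα (z + pair (fundPoint v n (q : ℕ)) ω)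
  filter_upwards [hev] with t ht hs
  obtain ⟨h1, h2⟩ := norm_exp_lt_one_of_summable hn hs
  -- The series diverges at `t = 0`.
  have ht0 : t ≠ 0 := by rintro rfl; simp at h2
  rw [(hasSum_exp_interior_tildeCone hn ω h1 h2).tsum_eq,
    generating_eq_sum_tripleGenerating (h0 0) (h0 1) _ _ ht0]
  refine (hasSum_sum fun q _ => ht q).congr_fun fun k => ?_
  rw [tildeBernoulli, Finset.sum_mul, Finset.sum_div]

/-- Multiplication by `-i` turns positive imaginary parts into positive real parts. A small negative
real perturbation preserves this and also makes `-c`, the third coordinate, have positive real part.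
-/
theorem exists_direction (hω : ∀ f, 0 < (pair (ray v n f) ω).im) :
    ∃ c : ℂ, c ≠ 0 ∧ c.re < 0 ∧ ∀ f, 0 < (c * pair (ray v n f) ω).re := by
  have hlim : ∀ f, ∀ᶠ ε : ℝ in 𝓝[>] 0,
      0 < ((-Complex.I - ε) * pair (ray v n f) ω).re := by
    intro f
    have hc : Continuous fun ε : ℝ => ((-Complex.I - ε) * pair (ray v n f) ω).re := by fun_prop
    have h0 := hc.tendsto 0
    refine (h0.mono_left nhdsWithin_le_nhds).eventually_const_lt ?_
    simpa using hω f
  obtain ⟨ε, hε, hε0⟩ := ((eventually_all.mpr hlim).and self_mem_nhdsWithin).exists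
  have hε0 : 0 < ε := hε0
  refine ⟨-Complex.I - ε, fun h => ?_, by simpa using hε0, hε⟩
  have := congrArg Complex.re h
  simp at this
  linarith

theorem frequently_summable_tilde (hn : ∀ f, IsFaceVector v f (n f))
    (hω : ∀ f, 0 < (pair (ray v n f) ω).im) : ∃ᶠ t in 𝓝[≠] (0 : ℂ),
    Summable (fun p : latticePoints (interior (cone (tildeNormals v))) =>
        Complex.exp (-(pair p ![ω 0, ω 1, -1]) * t)) := by
  obtain ⟨c, hc0, hcre, hc⟩ := exists_direction hω
  have hlim : Tendsto (fun s : ℝ => (s : ℂ) * c) (𝓝[>] (0 : ℝ)) (𝓝[≠] (0 : ℂ)) := by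
    refine tendsto_nhdsWithin_iff.mpr ⟨?_, ?_⟩
    · have : Continuous fun s : ℝ => (s : ℂ) * c := by fun_prop
      simpa using (this.tendsto 0).mono_left nhdsWithin_le_nhds
    · filter_upwards [self_mem_nhdsWithin] with s hs
      have hs : s ≠ 0 := ne_of_gt hs
      exact mul_ne_zero (by exact_mod_cast hs) hc0
  refine hlim.frequently (Eventually.frequently ?_)
  filter_upwards [self_mem_nhdsWithin] with s hs
  have hs : 0 < s := hs
  refine (hasSum_exp_interior_tildeCone hn ω (fun f => ?_) ?_).summable
  · rw [Complex.norm_exp, Real.exp_lt_one_iff, neg_mul, mul_assoc, Complex.neg_re,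
      Complex.re_ofReal_mul, neg_lt_zero]
    exact mul_pos hs (hc f)
  · rw [Complex.norm_exp, Real.exp_lt_one_iff, Complex.re_ofReal_mul]
    exact mul_neg_of_pos_of_neg hs hcre

theorem coneIndex_mul_apply (hn : ∀ f, IsFaceVector v f (n f)) (u : Fin 2 → ℝ) (y : Fin 2 → ℝ) :
    coneIndex v n * (y ⬝ᵥ u) = (u ⬝ᵥ toReal (v 1)) * (y ⬝ᵥ toReal (ray v n 0)) +
      (u ⬝ᵥ toReal (v 0)) * (y ⬝ᵥ toReal (ray v n 1)) := by
  have h0 := coneIndex_smul hn ![1, 0]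
  have h1 := coneIndex_smul hn ![0, 1]
  have h00 := congrFun h0 0
  have h01 := congrFun h0 1
  have h10 := congrFun h1 0
  have h11 := congrFun h1 1
  simp [dotProduct, Fin.sum_univ_two] at h00 h01 h10 h11
  rify at h00 h01 h10 h11
  simp only [dotProduct, Fin.sum_univ_two, toReal]
  linear_combination u 0 * y 0 * h00 + u 0 * y 1 * h01 + u 1 * y 0 * h10 + u 1 * y 1 * h11

theorem exists_mem_interior_dualCone_tilde (hn : ∀ f, IsFaceVector v f (n f))
    (hω : ∀ f, 0 < (pair (ray v n f) ω).im) :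
    ∃ c : ℂ, c ≠ 0 ∧ (fun j => (c * ![ω 0, ω 1, -1] j).re) ∈
      interior (dualCone (cone (tildeNormals v))) := by
  obtain ⟨c, hc0, hcre, hc⟩ := exists_direction hω
  have hN : (0 : ℝ) < coneIndex v n := by exact_mod_cast coneIndex_pos hn
  refine ⟨c, hc0, ?_⟩
  have hsub : {y : Fin 3 → ℝ | 0 < y 2 ∧ ∀ f, 0 < y 0 * ray v n f 0 + y 1 * ray v n f 1} ⊆
      dualCone (cone (tildeNormals v)) := by
    rintro y ⟨hy2, hy⟩ u hu
    have hu0 := hu 0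
    have hu1 := hu 1
    have hu2 := hu 2
    simp [dotProduct, Fin.sum_univ_succ, tildeNormals, toReal] at hu0 hu1 hu2
    have h := coneIndex_mul_apply hn ![u 0, u 1] ![y 0, y 1]
    have hy0 := hy 0
    have hy1 := hy 1
    simp only [dotProduct, Fin.sum_univ_two, toReal, Matrix.cons_val_zero, Matrix.cons_val_one] at h
    have h2 : 0 ≤ y 0 * u 0 + y 1 * u 1 := by
      refine nonneg_of_mul_nonneg_right ?_ hN
      rw [h]
      exact add_nonneg (mul_nonneg hu1 hy0.le) (mul_nonneg hu0 hy1.le)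
    have h3 := mul_nonneg hy2.le hu2
    simp only [dotProduct, Fin.sum_univ_three]
    linarith
  refine interior_maximal hsub ?_ ⟨?_, fun f => ?_⟩
  · simp only [Set.ofPred_and, Set.ofPred_forall]
    refine IsOpen.inter (isOpen_lt continuous_const (by fun_prop))
      (isOpen_iInter_of_finite fun f => isOpen_lt continuous_const (by fun_prop))
  · simpa using hcre
  · have h := hc f
    rw [pair, Fin.sum_univ_two] at h
    simp at h ⊢
    linarith

theorem isBernoulli_tildeBernoulli (hn : ∀ f, IsFaceVector v f (n f))
    (hω : ∀ f, 0 < (pair (ray v n f) ω).im) (z : ℂ) :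
    IsBernoulli (tildeNormals v) ![ω 0, ω 1, -1] z (tildeBernoulli v n ω z) :=
  ⟨exists_mem_interior_dualCone_tilde hn hω, eventually_hasSum_tildeBernoulli hn hω z⟩

/-- Points of convergence accumulate at `0`, so the difference of the two power series vanishes
often enough to be zero. -/
theorem isBernoulli_unique (hn : ∀ f, IsFaceVector v f (n f))
    (hω : ∀ f, 0 < (pair (ray v n f) ω).im) {z : ℂ} {b b' : ℕ → ℂ}
    (hb : IsBernoulli (tildeNormals v) ![ω 0, ω 1, -1] z b)
    (hb' : IsBernoulli (tildeNormals v) ![ω 0, ω 1, -1] z b') : b = b' := by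
  have h : (fun k => (b k - b' k) / (k ! : ℂ)) = 0 := by
    refine eq_zero_of_frequently_hasSum_zero ?_
    refine ((frequently_summable_tilde hn hω).and_eventually
      ((hb.2.and hb'.2).filter_mono nhdsWithin_le_nhds)).mono ?_
    rintro t ⟨hs, h1, h2⟩
    have := (h1 hs).sub (h2 hs)
    rw [sub_self] at this
    exact this.congr_fun fun k => by ring
  ext k
  have hk := congrFun h k
  have : (k ! : ℂ) ≠ 0 := by exact_mod_cast k.factorial_ne_zero
  simpa [this, sub_eq_zero] using hk

theorem bernoulli_tildeNormals (hn : ∀ f, IsFaceVector v f (n f))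
    (hω : ∀ f, 0 < (pair (ray v n f) ω).im) (z : ℂ) :
    (fun k => bernoulli (tildeNormals v) k z ![ω 0, ω 1, -1]) = tildeBernoulli v n ω z := by
  have h : ∃ b, IsBernoulli (tildeNormals v) ![ω 0, ω 1, -1] z b :=
    ⟨_, isBernoulli_tildeBernoulli hn hω z⟩
  simp only [bernoulli, dif_pos h]
  exact isBernoulli_unique hn hω h.choose_spec (isBernoulli_tildeBernoulli hn hω z)

end ConeGamma

/-! ### The factorization on a segment -/

/-- By Leibniz's rule for `exp (z * t)` times a factor free of `z`, this is a polynomial in `z`. -/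
theorem differentiable_iteratedDeriv_tripleGenerating {α : Fin 3 → ℂ} (hα : ∀ i, α i ≠ 0)
    (k : ℕ) : Differentiable ℂ fun z => iteratedDeriv k (tripleGenerating α z) 0 := by
  set g : ℂ → ℂ := fun t => ∏ i, (α i * dslope Complex.exp 0 (α i * t))⁻¹ with hg
  have hg0 : ContDiffAt ℂ k g 0 := by
    have h := (analyticAt_tripleGenerating hα 0).contDiffAt (n := k)
    refine h.congr_of_eventuallyEq (Eventually.of_forall fun t => ?_)
    simp [tripleGenerating, hg]
  have h : ∀ z, iteratedDeriv k (tripleGenerating α z) 0 =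
      ∑ i ∈ Finset.range (k + 1), k.choose i * z ^ i * iteratedDeriv (k - i) g 0 := by
    intro z
    have h1 : tripleGenerating α z = fun t => Complex.exp (z * t) * g t := rfl
    rw [h1, iteratedDeriv_fun_mul (by fun_prop) hg0]
    simp [iteratedDeriv_cexp_const_mul]
  simp only [h]
  fun_prop

namespace ConeGamma

variable {v n : Fin 2 → Fin 2 → ℤ} {ω : Fin 2 → ℂ}

theorem differentiable_tildeBernoulli (hω : ∀ f, 0 < (pair (ray v n f) ω).im) (k : ℕ) :
    Differentiable ℂ fun z => tildeBernoulli v n ω z k := by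
  have h0 : ∀ f, pair (ray v n f) ω ≠ 0 := fun f h => by
    have := hω f
    simp [h] at this
  refine Differentiable.fun_sum fun q _ => ?_
  exact (differentiable_iteratedDeriv_tripleGenerating
    (by intro i; fin_cases i <;> simp [h0]) k).comp (differentiable_id.add_const _)

theorem im_pair_ray_div_ray_ne_zero (hn : ∀ f, IsFaceVector v f (n f))
    (hω : (ω 0 / ω 1).im ≠ 0) (f : Fin 2) (h0 : pair (ray v n f) ω ≠ 0) :
    (pair (ray v n (1 - f)) ω / pair (ray v n f) ω).im ≠ 0 := by
  have him := im_corayVec_div_ray_ne_zero hn hω f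
  have hN : (coneIndex v n : ℝ) ≠ 0 := by exact_mod_cast (coneIndex_pos hn).ne'
  rw [pair_ray_other hn, sub_div, mul_div_assoc, mul_div_assoc, div_self h0, mul_one,
    Complex.sub_im, Complex.intCast_im, sub_zero, ← Complex.ofReal_intCast, Complex.im_ofReal_mul]
  exact mul_ne_zero hN him

theorem im_neg_one_div_ne_zero {a : ℂ} (ha : a.im ≠ 0) : (-1 / a).im ≠ 0 := by
  have ha0 : a ≠ 0 := by rintro rfl; simp at ha
  rw [neg_div, one_div, Complex.neg_im, Complex.inv_im]
  exact neg_ne_zero.mpr (div_ne_zero (neg_ne_zero.mpr ha) (by simpa using ha0))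

/-- The series of the pull-back of the elliptic gamma function to a face, as a sum over the
fundamental points. -/
theorem pullbackG_eq_exp_sum (hn : ∀ f, IsFaceVector v f (n f)) (hω' : (ω 0 / ω 1).im ≠ 0)
    (f : Fin 2) (ha : (pair (ray v n f) ω).im ≠ 0) {z : ℂ} {s r u : ℝ}
    (hs : s ∈ Set.Ioo (0 : ℝ) 1) (hu : u ∈ Set.Ioo (0 : ℝ) 1)
    (hz : z = r * pair (ray v n f) ω + u / coneIndex v n * pair (ray v n (1 - f)) ω - s)
    {A : Fin (coneIndex v n).toNat → ℂ}
    (hA : ∀ q : Fin (coneIndex v n).toNat, HasSum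
      (gammaTerm ((z + pair (fundPoint v n (q : ℕ)) ω) / pair (ray v n f) ω)
        (-1 / pair (ray v n f) ω) (pair (ray v n (1 - f)) ω / pair (ray v n f) ω)) (A q)) :
    pullbackG (S * K (n f) (v f)) z ω = Complex.exp (∑ q, A q) := by
  have ha0 : pair (ray v n f) ω ≠ 0 := by intro h; simp [h] at ha
  have hN : (coneIndex v n : ℂ) ≠ 0 := by exact_mod_cast (coneIndex_pos hn).ne'
  -- Substituting for the other ray leaves a real number, invisible to imaginary parts, plus a point
  -- of the strip for `-1 / a` and `b / a` with coordinates `s`, `u`.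
  have hza : z / pair (ray v n f) ω = ((r - u * corayShift v n f / coneIndex v n : ℝ) : ℂ) +
      (s * (-1 / pair (ray v n f) ω) +
        u * (pair (corayVec v n f) ω / pair (ray v n f) ω)) := by
    rw [hz, pair_ray_other hn]
    push_cast
    field_simp
    ring
  obtain ⟨T, hT, hG⟩ := G_one_eq_exp (z := z / pair (ray v n f) ω)
    (im_neg_one_div_ne_zero ha) (im_corayVec_div_ray_ne_zero hn hω' f) hs hu (by
      rw [hza, Complex.add_im, Complex.ofReal_im, zero_add, Complex.add_im, Complex.im_ofReal_mul,
        Complex.im_ofReal_mul])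
  rw [pullbackG_S_mul_K, hG]
  congr 1
  refine hT.unique ((hasSum_sum fun q (_ : q ∈ Finset.univ) => hA q).congr_fun fun k => ?_)
  exact (sum_gammaTerm_fundPoint hn hω' f ha0 z _ k).symm

theorem coneIndex_mul_fundPoint (hn : ∀ f, IsFaceVector v f (n f)) (q : ℤ) :
    coneIndex v n * pair (fundPoint v n q) ω =
      ((q * corayShift v n 0 % coneIndex v n : ℤ) : ℂ) * pair (ray v n 0) ω +
        q * pair (ray v n 1) ω := by
  rw [coneIndex_mul_pair hn, fundPoint_dotProduct_zero hn, fundPoint_dotProduct_one]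

/-- The factorization on a segment in the common domain of convergence of all series. -/
theorem coneG_one_eq_on_segment (hn : ∀ f, IsFaceVector v f (n f))
    (hω : ∀ f, 0 < (pair (ray v n f) ω).im) (hω' : (ω 0 / ω 1).im ≠ 0) {ε : ℝ}
    (hε : ε ∈ Set.Ioo (0 : ℝ) 1) {z : ℂ}
    (hz : z = (ε * pair (ray v n 0) ω + (1 / 2 : ℝ) * pair (ray v n 1) ω) / coneIndex v n -
      (1 / 2 : ℝ)) :
    coneG 1 v z ω = Complex.exp (Real.pi * Complex.I / 3 * tildeBernoulli v n ω z 3) *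
      ∏ f : Fin 2, pullbackG (S * K (n f) (v f)) z ω := by
  have hNpos := coneIndex_pos hn
  have hNR : (0 : ℝ) < coneIndex v n := by exact_mod_cast hNpos
  have hN : (coneIndex v n : ℂ) ≠ 0 := by exact_mod_cast hNpos.ne'
  have hP := fun q : Fin (coneIndex v n).toNat => coneIndex_mul_fundPoint (ω := ω) hn (q : ℕ)
  have hhalf : (1 / 2 : ℝ) ∈ Set.Ioo (0 : ℝ) 1 := by norm_num
  have ha := hω 0
  have hc := hω 1
  have ha0 : pair (ray v n 0) ω ≠ 0 := fun h => by simp [h] at ha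
  have hc0 : pair (ray v n 1) ω ≠ 0 := fun h => by simp [h] at hc
  have hca := im_pair_ray_div_ray_ne_zero hn hω' 0 ha0
  have hac := im_pair_ray_div_ray_ne_zero hn hω' 1 hc0
  have hpull0 := fun A => pullbackG_eq_exp_sum hn hω' 0 ha.ne' (z := z) (s := 1 / 2)
    (r := ε / coneIndex v n) (u := 1 / 2) hhalf hhalf (by
      rw [hz, sub_zero]; push_cast; field_simp) (A := A)
  have hpull1 := fun A => pullbackG_eq_exp_sum hn hω' 1 hc.ne' (z := z) (s := 1 / 2)
    (r := 1 / 2 / coneIndex v n) (u := ε) hhalf hε (by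
      rw [hz, sub_self]; push_cast; field_simp; ring) (A := A)
  rw [sub_zero] at hca hpull0
  rw [sub_self] at hac hpull1
  obtain ⟨T, hT, hG⟩ := coneG_one_eq_exp hn hω (z := z) (by
      rw [hz, ← Complex.ofReal_intCast, Complex.sub_im, Complex.div_ofReal_im, Complex.add_im,
        Complex.im_ofReal_mul, Complex.im_ofReal_mul, Complex.ofReal_im, sub_zero]
      have := hε.1
      positivity) (by
      rw [hz, ← Complex.ofReal_intCast, Complex.sub_im, Complex.div_ofReal_im, Complex.add_im,
        Complex.im_ofReal_mul, Complex.im_ofReal_mul, Complex.ofReal_im, sub_zero,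
        mul_div_cancel₀ _ hNR.ne']
      nlinarith [hε.2])
  set a := pair (ray v n 0) ω
  set c := pair (ray v n 1) ω
  have hsplit : ∀ q : Fin (coneIndex v n).toNat, ∃ S A C : ℂ,
      HasSum (gammaTerm (z + pair (fundPoint v n (q : ℕ)) ω) a c) S ∧
      HasSum (gammaTerm ((z + pair (fundPoint v n (q : ℕ)) ω) / a) (-1 / a) (c / a)) A ∧
      HasSum (gammaTerm ((z + pair (fundPoint v n (q : ℕ)) ω) / c) (-1 / c) (a / c)) C ∧
      S = Real.pi * Complex.I / 3 * iteratedDeriv 3 (tripleGenerating ![a, c, -1]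
        (z + pair (fundPoint v n (q : ℕ)) ω)) 0 + A + C := by
    intro q
    set w := z + pair (fundPoint v n (q : ℕ)) ω with hw
    set r : ℤ := (q : ℕ) * corayShift v n 0 % coneIndex v n with hr
    have hr0 : (0 : ℝ) ≤ r := by exact_mod_cast Int.emod_nonneg _ hNpos.ne'
    have hr1 : (r : ℝ) + 1 ≤ coneIndex v n := by
      have : r < coneIndex v n := Int.emod_lt_of_pos _ hNpos
      exact_mod_cast this
    have hq1 : (q : ℝ) + 1 ≤ coneIndex v n := by
      have := q.2
      have h2 : ((q : ℕ) : ℤ) + 1 ≤ coneIndex v n := by omega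
      exact_mod_cast h2
    -- The fundamental point adds `r / N` and `q / N`, with `0 ≤ r, q ≤ N - 1`, to the coordinates
    -- `ε / N` and `1 / (2N)` of `z`. All translates therefore stay in the open unit box.
    set s : Fin 3 → ℝ := ![(r + ε) / coneIndex v n, (q + 1 / 2) / coneIndex v n, 1 / 2] with hs
    have hs01 : ∀ i, s i ∈ Set.Ioo (0 : ℝ) 1 := by
      have := hε.1
      have := hε.2
      intro i
      fin_cases i
      · exact ⟨by simp only [hs, Fin.zero_eta, Matrix.cons_val]; positivity,
          by simp only [hs, Fin.zero_eta, Matrix.cons_val]; rw [div_lt_one hNR]; linarith⟩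
      · exact ⟨by simp only [hs, Fin.mk_one, Matrix.cons_val]; positivity,
          by simp only [hs, Fin.mk_one, Matrix.cons_val]; rw [div_lt_one hNR]; linarith⟩
      · exact hhalf
    have hws : w = s 0 * a + s 1 * c - s 2 := by
      have h := hP q
      have h' : pair (fundPoint v n (q : ℕ)) ω = (r * a + (q : ℕ) * c) / coneIndex v n := by
        rw [eq_div_iff hN, mul_comm, h]
        push_cast
        rfl
      rw [hw, h', hz]
      simp only [hs, Matrix.cons_val]
      push_cast
      field_simp
      ring
    have him : ∀ (x y : ℝ) (τ σ : ℂ), ((x : ℂ) * τ + y * σ).im = x * τ.im + y * σ.im :=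
      fun x y τ σ => by rw [Complex.add_im, Complex.im_ofReal_mul, Complex.im_ofReal_mul]
    obtain ⟨S, hS, -⟩ := G_one_eq_exp (z := w) ha.ne' hc.ne' (hs01 0) (hs01 1) (by
      rw [hws, Complex.sub_im, him, Complex.ofReal_im, sub_zero])
    obtain ⟨A, hA, -⟩ := G_one_eq_exp (z := w / a) (im_neg_one_div_ne_zero ha.ne') hca
      (hs01 2) (hs01 1) (by
        rw [show w / a = (s 0 : ℂ) + (s 2 * (-1 / a) + s 1 * (c / a)) by
          rw [hws]; field_simp; ring, Complex.add_im, him, Complex.ofReal_im, zero_add])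
    obtain ⟨C, hC, -⟩ := G_one_eq_exp (z := w / c) (im_neg_one_div_ne_zero hc.ne') hac
      (hs01 2) (hs01 0) (by
        rw [show w / c = (s 1 : ℂ) + (s 2 * (-1 / c) + s 0 * (a / c)) by
          rw [hws]; field_simp; ring, Complex.add_im, him, Complex.ofReal_im, zero_add])
    exact ⟨S, A, C, hS, hA, hC, gammaTerm_modular ha.ne' hc.ne' hac hs01 hws hS hA hC⟩
  choose σ A C hσ hA hC hmod using hsplit
  have hTσ : T = ∑ q, σ q := hT.unique (hasSum_sum fun q _ => hσ q)
  rw [hG, Fin.prod_univ_two, hpull0 A hA, hpull1 C hC, ← Complex.exp_add, ← Complex.exp_add, hTσ,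
    tildeBernoulli, Finset.mul_sum, ← Finset.sum_add_distrib, ← Finset.sum_add_distrib]
  congr 1
  exact Finset.sum_congr rfl fun q _ => by rw [hmod q, add_assoc]

theorem meromorphic_pullbackG (hn : ∀ f, IsFaceVector v f (n f))
    (hω : ∀ f, 0 < (pair (ray v n f) ω).im) (hω' : (ω 0 / ω 1).im ≠ 0) (f : Fin 2) :
    Meromorphic fun z => pullbackG (S * K (n f) (v f)) z ω := by
  simp only [pullbackG_S_mul_K]
  intro z
  exact (meromorphic_G_one (im_neg_one_div_ne_zero (hω f).ne')
    (im_corayVec_div_ray_ne_zero hn hω' f) _).comp_analyticAt (g := fun z => z / _) (by fun_prop)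

end ConeGamma

/-! ### Analytic continuation and the theorem -/

/-- The identity theorem for meromorphic functions on the plane. -/
theorem Meromorphic.eq_of_frequently_eq {f g : ℂ → ℂ} (hf : Meromorphic f) (hg : Meromorphic g)
    {z₀ : ℂ} (h : ∃ᶠ z in 𝓝[≠] z₀, f z = g z) {z : ℂ} (hfz : AnalyticAt ℂ f z)
    (hgz : AnalyticAt ℂ g z) : f z = g z := by
  have hfg : MeromorphicOn (f - g) Set.univ := fun z _ => (hf z).sub (hg z)
  have h0 : meromorphicOrderAt (f - g) z₀ = ⊤ := by
    rw [meromorphicOrderAt_eq_top_iff]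
    refine (hfg z₀ trivial).eventually_eq_zero_or_eventually_ne_zero.resolve_right fun hne => h ?_
    filter_upwards [hne] with z hz
    exact sub_ne_zero.mp hz
  have hz : meromorphicOrderAt (f - g) z = ⊤ := by
    by_contra hz
    exact hfg.meromorphicOrderAt_ne_top_of_isPreconnected isPreconnected_univ trivial trivial hz h0
  rw [meromorphicOrderAt_eq_top_iff] at hz
  have h1 := ((hfz.sub hgz).frequently_zero_iff_eventually_zero.mp hz.frequently).self_of_nhds
  exact sub_eq_zero.mp h1

end EllipticGammaModularity

theorem mainTheorem4 (v : Fin 2 → Fin 2 → ℤ) (hv : ConeGamma.IsGoodCone v)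
    (ω : Fin 2 → ℂ)
    (hω : (fun j => (ω j).im) ∈ interior (ConeGamma.dualCone (ConeGamma.cone v)))
    (hω' : (ω 0 / ω 1).im ≠ 0)
    (n : Fin 2 → Fin 2 → ℤ) (hn : ∀ f, ConeGamma.IsFaceVector v f (n f)) :
    -- the infinite products that define the left-hand side converge
    (∀ z : ℂ,
      Multipliable (fun p : ConeGamma.latticePoints (ConeGamma.cone v) =>
        1 - ConeGamma.e (z + ConeGamma.pair p ω)) ∧
      Multipliable (fun p : ConeGamma.latticePoints (interior (ConeGamma.cone v)) =>
        1 - ConeGamma.e (-z + ConeGamma.pair p ω))) ∧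
    -- the generalized Bernoulli polynomials of the three-dimensional cone are well defined
    (∀ z : ℂ, ConeGamma.IsBernoulli (ConeGamma.tildeNormals v) ![ω 0, ω 1, -1] z
      (fun k => ConeGamma.bernoulli (ConeGamma.tildeNormals v) k z ![ω 0, ω 1, -1])) ∧
    -- all functions involved are meromorphic on the plane
    MeromorphicOn (fun z => ConeGamma.coneG 1 v z ω) Set.univ ∧
    (∀ f, MeromorphicOn
      (fun z => ConeGamma.pullbackG (ConeGamma.S * ConeGamma.K (n f) (v f)) z ω) Set.univ) ∧
    -- the factorization, wherever all functions involved are regular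
    ∀ z : ℂ,
      AnalyticAt ℂ (fun y => ConeGamma.coneG 1 v y ω) z →
      (∀ f, AnalyticAt ℂ
        (fun y => ConeGamma.pullbackG (ConeGamma.S * ConeGamma.K (n f) (v f)) y ω) z) →
      ConeGamma.coneG 1 v z ω =
        Complex.exp (Real.pi * Complex.I / 3 *
          ConeGamma.bernoulli (ConeGamma.tildeNormals v) 3 z ![ω 0, ω 1, -1]) *
        ∏ f : Fin 2, ConeGamma.pullbackG (ConeGamma.S * ConeGamma.K (n f) (v f)) z ω := by
  have hω0 : ∀ f, 0 < (ConeGamma.pair (ConeGamma.ray v n f) ω).im := by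
    intro f
    rw [ConeGamma.pair_im]
    refine ConeGamma.dotProduct_pos_of_mem_interior_dualCone hω (fun i => ?_) fun h => ?_
    · rw [ConeGamma.toReal_dotProduct_toReal]
      have : i = f ∨ i = 1 - f := by fin_cases i <;> fin_cases f <;> simp
      rcases this with rfl | rfl
      · rw [(ConeGamma.ray_dotProduct hn _).2.1, Int.cast_zero]
      · exact_mod_cast (ConeGamma.ray_dotProduct_other_pos hn f).le
    · refine ConeGamma.ray_ne_zero hn f (funext fun j => ?_)
      have := congrFun h j
      simpa [ConeGamma.toReal] using this
  have hG := ConeGamma.meromorphic_coneG_one hn hω0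
  have hpull := ConeGamma.meromorphic_pullbackG hn hω0 hω'
  have hbern := ConeGamma.bernoulli_tildeNormals hn hω0
  have hexp : Differentiable ℂ fun z => Complex.exp (Real.pi * Complex.I / 3 *
      ConeGamma.tildeBernoulli v n ω z 3) := by
    have := ConeGamma.differentiable_tildeBernoulli (n := n) hω0 3
    fun_prop
  refine ⟨fun z => ⟨?_, ?_⟩, fun z => ?_, hG.meromorphicOn, fun f => (hpull f).meromorphicOn,
    fun z hz hzf => ?_⟩
  · simpa only [ConeGamma.e_add] using
      multipliable_one_sub_mul (ConeGamma.summable_e_cone hn hω0) (ConeGamma.e z)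
  · simpa only [ConeGamma.e_add] using
      multipliable_one_sub_mul (ConeGamma.summable_e_interior_cone hn hω0) (ConeGamma.e (-z))
  · rw [hbern]
    exact ConeGamma.isBernoulli_tildeBernoulli hn hω0 z
  · rw [show ConeGamma.bernoulli (ConeGamma.tildeNormals v) 3 z ![ω 0, ω 1, -1] =
      ConeGamma.tildeBernoulli v n ω z 3 from congrFun (hbern z) 3]
    set N : ℂ := ((ConeGamma.coneIndex v n : ℤ) : ℂ)
    set a := ConeGamma.pair (ConeGamma.ray v n 0) ω with ha
    set c := ConeGamma.pair (ConeGamma.ray v n 1) ω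
    have hN : N ≠ 0 := Int.cast_ne_zero.mpr (ConeGamma.coneIndex_pos hn).ne'
    have ha0 : a ≠ 0 := fun h => by
      have := hω0 0
      rw [← ha, h] at this
      simp at this
    -- The segment of `coneG_one_eq_on_segment`. As `a ≠ 0`, the path is injective, so its points
    -- accumulate at `p (1 / 2)` without equalling it.
    let p : ℝ → ℂ := fun ε => (ε * a + (1 / 2 : ℝ) * c) / N - (1 / 2 : ℝ)
    have hp : Filter.Tendsto p (𝓝[≠] (1 / 2)) (𝓝[≠] (p (1 / 2))) := by
      have hc : Continuous p := by fun_prop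
      refine tendsto_nhdsWithin_iff.mpr ⟨(hc.tendsto _).mono_left nhdsWithin_le_nhds, ?_⟩
      filter_upwards [self_mem_nhdsWithin] with ε hε h
      simp only [p, Set.mem_singleton_iff, sub_left_inj, div_left_inj' hN, add_left_inj,
        mul_eq_mul_right_iff, ha0, or_false, Complex.ofReal_inj] at h
      exact hε h
    refine Meromorphic.eq_of_frequently_eq (z₀ := p (1 / 2)) hG
      (g := fun z => Complex.exp (Real.pi * Complex.I / 3 * ConeGamma.tildeBernoulli v n ω z 3) *
        ∏ f : Fin 2, ConeGamma.pullbackG (ConeGamma.S * ConeGamma.K (n f) (v f)) z ω)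
      (fun y => (hexp.analyticAt y).meromorphicAt.mul
        (MeromorphicAt.fun_prod fun f _ => hpull f y)) ?_ hz
      ((hexp.analyticAt z).mul (Finset.analyticAt_fun_prod _ fun f _ => hzf f))
    refine hp.frequently (Filter.Eventually.frequently ?_)
    have hmem : Set.Ioo (0 : ℝ) 1 ∈ 𝓝[≠] (1 / 2 : ℝ) :=
      mem_nhdsWithin_of_mem_nhds (Ioo_mem_nhds (by norm_num) (by norm_num))
    filter_upwards [hmem] with ε hε
    exact ConeGamma.coneG_one_eq_on_segment hn hω0 hω' hε rfl
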